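/- Let $0\le r\le n$ be integers and $[n]=\{1,\dots,n\}$. Let $$A^*(U_{n,n})=\frac{\mathbb{Z}[x_S : \emptyset\neq S\subseteq [n]]}{\langle x_Sx_T : S\not\subseteq T \text{ and } T\not\subseteq S\rangle+\langle \sum_{S\ni e}x_S : e\in[n]\rangle}$$ be the Chow ring of the free matroid on $[n]$. For a matroid $M$ on $[n]$ with rank function $\mathrm{rank}$ and nullity function $\mathrm{null}(S)=|S|-\mathrm{rank}(S)$, the rank-nullity ring $R^*(M)$ is the subring of $A^*(U_{n,n})$ generated over $\mathbb{Z}$ by the elements $$y_{i,j}=\sum_{\substack{\emptyset\ne S\subseteq[n]\\ \mathrm{rank}(S)=i,\ \mathrm{null}(S)=j}}x_S,\qquad 0\le i,j\le n.$$ Let $U_{r,n}$ be the uniform matroid of rank $r$ on $[n]$ (a set is independent if and only if it has at most $r$ elements), and for $1\le s\le n$ let $z_s=\sum_{|S|=s}x_S\in A^*(U_{n,n})$. Then $R^*(U_{r,n})$ is a free $\mathbb{Z}$-module, and the monomials $$z_{s_1}^{p_1}z_{s_2}^{p_2}\cdots z_{s_l}^{p_l},\qquad l\ge 0,\quad 1\le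 s_1<s_2<\dots<s_l\le n,\quad 1\le p_i<s_i-s_{i-1}\ \text{ for } 1\le i\le l$$ (where $s_0=0$, and $l=0$ gives the monomial $1$), indexed by all such sequences $(s_i)$ and $(p_i)$, are pairwise distinct and form a $\mathbb{Z}$-basis of $R^*(U_{r,n})$. -/

import Mathlib

namespace RankNullity

open Classical in
/-- The uniform matroid `U_{r,n}` on an `n`-element set: the independent sets are the sets with
at most `r` elements. Its rank is `r` when `r ≤ n`. -/
noncomputable def uniformMatroid (r n : ℕ) : Matroid (Fin n) :=
  (IndepMatroid.ofFinset (Set.univ : Set (Fin n)) (fun I => I.card ≤ r)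
    (by simp)
    (fun _ _ hJ hIJ => (Finset.card_le_card hIJ).trans hJ)
    (fun I J _ hJ hlt => by
      obtain ⟨e, heJ, heI⟩ := Finset.exists_mem_notMem_of_card_lt_card hlt
      exact ⟨e, heJ, heI, by rw [Finset.card_insert_of_notMem heI]; omega⟩)
    (fun _ _ => Set.subset_univ _)).matroid

/-- The variables `x_S` of the permutahedral Chow ring: one for each nonempty subset `S ⊆ [n]`. -/
abbrev NonemptySubset (n : ℕ) : Type := {S : Finset (Fin n) // S.Nonempty}

/-- The ideal of relations of the permutahedral Chow ring, generated by the products `x_S x_T` for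
incomparable `S, T` and by the linear forms `∑_{S ∋ e} x_S` for `e ∈ [n]`. -/
noncomputable def chowIdeal (n : ℕ) : Ideal (MvPolynomial (NonemptySubset n) ℤ) :=
  Ideal.span
      {f | ∃ S T : NonemptySubset n, ¬ S.1 ⊆ T.1 ∧ ¬ T.1 ⊆ S.1 ∧
        f = MvPolynomial.X S * MvPolynomial.X T} ⊔
    Ideal.span
      {f | ∃ e : Fin n, f = ∑ S : NonemptySubset n with e ∈ S.1, MvPolynomial.X S}

/-- The Chow ring `A^*(U_{n,n})` of the free matroid on `[n]`, that is, of the permutahedral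
toric variety. Every nonempty subset of `[n]` is a nonempty flat of `U_{n,n}`. -/
abbrev PermChow (n : ℕ) : Type :=
  MvPolynomial (NonemptySubset n) ℤ ⧸ chowIdeal n

/-- The class of the variable `x_S` in `A^*(U_{n,n})`. -/
noncomputable def x {n : ℕ} (S : NonemptySubset n) : PermChow n :=
  Ideal.Quotient.mk (chowIdeal n) (MvPolynomial.X S)

/-- The rank function of a matroid on `[n]`. -/
noncomputable def rank {n : ℕ} (M : Matroid (Fin n)) (S : Finset (Fin n)) : ℕ :=
  (M.eRk (S : Set (Fin n))).toNat

/-- The rank of a set is at most its size, so the subtraction in `nullity` is never truncated. -/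
theorem rank_le_card {n : ℕ} (M : Matroid (Fin n)) (S : Finset (Fin n)) :
    rank M S ≤ S.card := by
  have h := M.eRk_le_encard (S : Set (Fin n))
  rw [Set.encard_coe_eq_coe_finsetCard] at h
  exact ENat.toNat_le_of_le_natCast h

/-- The nullity function of a matroid on `[n]`: `null(S) = |S| - rank(S)`. -/
noncomputable def nullity {n : ℕ} (M : Matroid (Fin n)) (S : Finset (Fin n)) : ℕ :=
  S.card - rank M S

/-- The element `y_{i,j}` of `A^*(U_{n,n})`: the sum of the `x_S` over all nonempty `S ⊆ [n]` of
rank `i` and nullity `j` in `M`. -/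
noncomputable def y {n : ℕ} (M : Matroid (Fin n)) (i j : ℕ) : PermChow n :=
  ∑ S : NonemptySubset n with rank M S.1 = i ∧ nullity M S.1 = j, x S

/-- The rank-nullity ring `R^*(M) = ℤ[y_{i,j} : 0 ≤ i, j ≤ n] ⊆ A^*(U_{n,n})` of a matroid `M`
with ground set `[n]`. -/
noncomputable def rankNullityRing {n : ℕ} (M : Matroid (Fin n)) : Subalgebra ℤ (PermChow n) :=
  Algebra.adjoin ℤ {a | ∃ i j : ℕ, i ≤ n ∧ j ≤ n ∧ a = y M i j}

/-- The element `z_s = ∑_{|S| = s} x_S` of `A^*(U_{n,n})`. -/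
noncomputable def z (n s : ℕ) : PermChow n :=
  ∑ S : NonemptySubset n with S.1.card = s, x S

/-- For an exponent vector `p` with support `{s_1 < ⋯ < s_l}`, this is `s_{i-1}` at `s = s_i`:
the largest element of the support below `s`, and `0` if there is none. -/
def prev (p : ℕ →₀ ℕ) (s : ℕ) : ℕ :=
  (p.support.filter (· < s)).sup id

/-- The index set of `𝓑_n`. A choice of `1 ≤ s_1 < ⋯ < s_l ≤ n` together with exponents
`p_1, …, p_l ≥ 1` is the same as an exponent vector `p : ℕ →₀ ℕ` supported in `{1, …, n}`: its
support is `{s_1, …, s_l}` and `p s_i = p_i`. The condition is `p_i < s_i - s_{i-1}`, where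
`s_0 = 0`. -/
abbrev BasisIndex (n : ℕ) : Type :=
  {p : ℕ →₀ ℕ // p.support ⊆ Finset.Icc 1 n ∧ ∀ s ∈ p.support, p s < s - prev p s}

/-- The monomial `z_{s_1}^{p_1} ⋯ z_{s_l}^{p_l}` with exponent vector `p`. -/
noncomputable def zMonomial (n : ℕ) (p : ℕ →₀ ℕ) : PermChow n :=
  ∏ s ∈ p.support, z n s ^ p s

end RankNullity

namespace RankNullity

/-- The binomial coefficient with an integer lower argument, zero if that is negative. -/
def chooseInt (a : ℕ) (e : ℤ) : ℤ := if 0 ≤ e then (a.choose e.toNat : ℤ) else 0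

theorem chooseInt_natCast (a k : ℕ) : chooseInt a (k : ℤ) = a.choose k := by
  simp [chooseInt]

theorem chooseInt_zero_right (a : ℕ) : chooseInt a 0 = 1 := by
  simp [chooseInt]

theorem chooseInt_of_neg (a : ℕ) {e : ℤ} (he : e < 0) : chooseInt a e = 0 := by
  simp [chooseInt, he]

theorem chooseInt_of_lt {a : ℕ} {e : ℤ} (he : (a : ℤ) < e) : chooseInt a e = 0 := by
  unfold chooseInt
  rw [if_pos (by omega), Nat.choose_eq_zero_of_lt (by omega), Nat.cast_zero]

theorem chooseInt_succ (a : ℕ) (e : ℤ) :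
    chooseInt (a + 1) (e + 1) = chooseInt a e + chooseInt a (e + 1) := by
  rcases lt_trichotomy e (-1) with h | rfl | h
  · rw [chooseInt_of_neg _ (by omega), chooseInt_of_neg _ (by omega),
      chooseInt_of_neg _ (by omega), add_zero]
  · norm_num [chooseInt]
  · obtain ⟨k, rfl⟩ := Int.eq_ofNat_of_zero_le (show 0 ≤ e by omega)
    have : ((k : ℤ) + 1) = ((k + 1 : ℕ) : ℤ) := by push_cast; rfl
    rw [this, chooseInt_natCast, chooseInt_natCast, chooseInt_natCast, Nat.choose_succ_succ]
    push_cast; rfl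

/-- The support of `p` below `n`. -/
def levels (n : ℕ) (p : ℕ → ℕ) : Finset ℕ := (Finset.range n).filter (fun s => p s ≠ 0)

theorem mem_levels {n : ℕ} {p : ℕ → ℕ} {s : ℕ} : s ∈ levels n p ↔ s < n ∧ p s ≠ 0 := by
  simp [levels]

/-- The smallest element above `s` of the support of `p` together with `n`. -/
noncomputable def next (n : ℕ) (p : ℕ → ℕ) (s : ℕ) : ℕ := sInf {v | s < v ∧ (p v ≠ 0 ∨ v = n)}

theorem next_isLeast {n s : ℕ} (p : ℕ → ℕ) (hs : s < n) :
    IsLeast {v | s < v ∧ (p v ≠ 0 ∨ v = n)} (next n p s) := by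
  have hne : {v | s < v ∧ (p v ≠ 0 ∨ v = n)}.Nonempty := ⟨n, hs, Or.inr rfl⟩
  exact ⟨Nat.sInf_mem hne, fun v hv => Nat.sInf_le hv⟩

theorem lt_next {n s : ℕ} (p : ℕ → ℕ) (hs : s < n) : s < next n p s := (next_isLeast p hs).1.1

theorem next_le {n s : ℕ} (p : ℕ → ℕ) (hs : s < n) : next n p s ≤ n :=
  (next_isLeast p hs).2 ⟨hs, Or.inr rfl⟩

theorem next_le_of_mem {n s v : ℕ} {p : ℕ → ℕ} (hs : s < n) (hv : s < v) (hp : p v ≠ 0) :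
    next n p s ≤ v :=
  (next_isLeast p hs).2 ⟨hv, Or.inl hp⟩

theorem next_mem {n s : ℕ} (p : ℕ → ℕ) (hs : s < n) :
    p (next n p s) ≠ 0 ∨ next n p s = n := (next_isLeast p hs).1.2

theorem next_eq_of {n s v : ℕ} {p : ℕ → ℕ} (hv : s < v) (hp : p v ≠ 0 ∨ v = n)
    (h : ∀ w, s < w → w < v → p w = 0 ∧ w ≠ n) : next n p s = v := by
  refine IsLeast.csInf_eq ⟨⟨hv, hp⟩, fun w hw => ?_⟩
  by_contra hlt
  have := h w hw.1 (not_le.mp hlt)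
  exact hw.2.elim (fun h' => h' this.1) this.2

theorem eq_zero_of_lt_next {n s w : ℕ} {p : ℕ → ℕ} (hs : s < n) (h1 : s < w)
    (h2 : w < next n p s) : p w = 0 := by
  by_contra h
  exact absurd (next_le_of_mem hs h1 h) (not_le.mpr h2)

/-- The excess of the cumulative degree of `p` at `s` over `s + 1`. -/
def excess (p : ℕ → ℕ) (s : ℕ) : ℤ := (∑ u ∈ Finset.range (s + 1), p u : ℕ) - 1 - s

/-- The contribution of level `s` to the degree of a chain monomial with exponent vector `p`. -/
noncomputable def levelWeight (n : ℕ) (p : ℕ → ℕ) (s : ℕ) : ℤ :=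
  -(chooseInt (p s - 1) (excess p s) * chooseInt (next n p s - s - 1) (excess p s))

/-- The degree, up to a global sign, of a monomial supported on a chain of subsets of `[n]` in the
permutahedral Chow ring. Here `p u` is the exponent of the member of size `u`, with the convention
that the empty set has exponent `1`. -/
noncomputable def chainDegree (n : ℕ) (p : ℕ → ℕ) : ℤ :=
  if ∑ u ∈ Finset.range (n + 1), p u = n then ∏ s ∈ levels n p, levelWeight n p s else 0

theorem sum_range_eq_sum_levels {n : ℕ} {p : ℕ → ℕ} (hp0 : p 0 ≠ 0) (f : ℕ → ℤ) :
    ∑ u ∈ Finset.range n, f u =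
      ∑ j ∈ levels n p, (f j + ∑ u ∈ Finset.Ioo j (next n p j), f u) := by
  have key : Finset.range n = (levels n p).biUnion (fun j => Finset.Ico j (next n p j)) := by
    ext u
    simp only [Finset.mem_range, Finset.mem_biUnion, mem_levels, Finset.mem_Ico]
    constructor
    · intro hu
      have hne : ((Finset.range (u + 1)).filter (fun s => p s ≠ 0)).Nonempty :=
        ⟨0, by simp [hp0]⟩
      obtain ⟨j, hj, hmax⟩ := Finset.exists_max_image _ id hne
      simp only [Finset.mem_filter, Finset.mem_range, id] at hj hmax
      refine ⟨j, ⟨by omega, hj.2⟩, by omega, ?_⟩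
      by_contra hlt
      rcases next_mem p (show j < n by omega) with h | h
      · have := hmax _ ⟨by omega, h⟩
        have := lt_next p (show j < n by omega)
        omega
      · omega
    · rintro ⟨j, ⟨hj, -⟩, -, h⟩
      exact h.trans_le (next_le p hj)
  have hdisj : ((levels n p : Finset ℕ) : Set ℕ).PairwiseDisjoint
      (fun j => Finset.Ico j (next n p j)) := by
    have aux : ∀ i j, i < j → i ∈ levels n p → j ∈ levels n p →
        Disjoint (Finset.Ico i (next n p i)) (Finset.Ico j (next n p j)) := by
      intro i j hij hi hj
      rw [mem_levels] at hi hj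
      have := next_le_of_mem hi.1 hij hj.2
      rw [Finset.disjoint_left]
      intro u hu hu'
      rw [Finset.mem_Ico] at hu hu'
      omega
    intro i hi j hj hij
    rcases lt_or_gt_of_ne hij with h | h
    · exact aux i j h hi hj
    · exact (aux j i h hj hi).symm
  rw [key, Finset.sum_biUnion hdisj]
  refine Finset.sum_congr rfl fun j hj => ?_
  rw [← Finset.sum_Ioo_add_eq_sum_Ico (lt_next p (mem_levels.mp hj).1), add_comm]

theorem prod_eq_prod_lt_mul_prod_gt {s : Finset ℕ} {j : ℕ} (hj : j ∈ s) (f : ℕ → ℤ) :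
    ∏ i ∈ s, f i = (∏ i ∈ s with i < j, f i) * f j * ∏ i ∈ s with j < i, f i := by
  rw [← Finset.prod_filter_mul_prod_filter_not s (fun i => i < j)]
  have h : s.filter (fun i => ¬ i < j) = insert j (s.filter (fun i => j < i)) := by
    ext i
    simp only [Finset.mem_filter, Finset.mem_insert]
    constructor
    · rintro ⟨h1, h2⟩
      rcases (not_lt.mp h2).eq_or_lt with h | h
      · exact Or.inl h.symm
      · exact Or.inr ⟨h1, h⟩
    · rintro (rfl | ⟨h1, h2⟩)
      · exact ⟨hj, lt_irrefl _⟩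
      · exact ⟨h1, h2.not_gt⟩
  rw [h, Finset.prod_insert (by simp), mul_assoc]

theorem sum_range_single (u m : ℕ) :
    ∑ v ∈ Finset.range m, (Pi.single u 1 : ℕ → ℕ) v = if u < m then 1 else 0 := by
  simp [Pi.single_apply]

theorem excess_add_single (p : ℕ → ℕ) (u s : ℕ) :
    excess (p + Pi.single u 1) s = excess p s + if u ≤ s then 1 else 0 := by
  unfold excess
  simp only [Pi.add_apply, Finset.sum_add_distrib, sum_range_single]
  split_ifs <;> push_cast <;> omega

theorem sum_range_add_single (p : ℕ → ℕ) {u n : ℕ} (hu : u ≤ n) :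
    ∑ v ∈ Finset.range (n + 1), (p + Pi.single u 1 : ℕ → ℕ) v = ∑ v ∈ Finset.range (n + 1), p v + 1 := by
  simp only [Pi.add_apply, Finset.sum_add_distrib, sum_range_single]
  rw [if_pos (by omega)]

/-- The level weight of `p` after one unit of degree has been added below `s`. -/
noncomputable def raisedWeight (n : ℕ) (p : ℕ → ℕ) (s : ℕ) : ℤ :=
  -(chooseInt (p s - 1) (excess p s + 1) * chooseInt (next n p s - s - 1) (excess p s + 1))

theorem next_add_single_of_ne_zero {n u : ℕ} {p : ℕ → ℕ} (hu : p u ≠ 0 ∨ u = n) (s : ℕ) :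
    next n (p + Pi.single u 1) s = next n p s := by
  unfold next
  congr 1
  ext v
  simp only [Set.mem_ofPred_eq, Pi.add_apply]
  by_cases h : v = u
  · subst h
    simp only [Pi.single_eq_same]
    tauto
  · simp [Pi.single_eq_of_ne h]

theorem chainDegree_add_single_top {n : ℕ} {p : ℕ → ℕ}
    (hsum : ∑ u ∈ Finset.range (n + 1), p u + 1 = n) :
    chainDegree n (p + Pi.single n 1) = ∏ s ∈ levels n p, levelWeight n p s := by
  unfold chainDegree
  rw [sum_range_add_single p le_rfl, if_pos hsum]
  have hl : levels n (p + Pi.single n 1) = levels n p := by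
    ext s
    simp only [mem_levels, Pi.add_apply]
    refine and_congr_right fun hs => ?_
    rw [Pi.single_eq_of_ne hs.ne, add_zero]
  rw [hl]
  refine Finset.prod_congr rfl fun s hs => ?_
  have hs := (mem_levels.mp hs).1
  unfold levelWeight
  rw [next_add_single_of_ne_zero (Or.inr rfl), excess_add_single, if_neg (by omega), add_zero,
    Pi.add_apply, Pi.single_eq_of_ne hs.ne, add_zero]

theorem chainDegree_add_single_level {n u : ℕ} {p : ℕ → ℕ} (hu : u ∈ levels n p)
    (hsum : ∑ u ∈ Finset.range (n + 1), p u + 1 = n) :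
    chainDegree n (p + Pi.single u 1) =
      (∏ s ∈ levels n p with s < u, levelWeight n p s) *
      (-(chooseInt (p u) (excess p u + 1) * chooseInt (next n p u - u - 1) (excess p u + 1))) *
      ∏ s ∈ levels n p with u < s, raisedWeight n p s := by
  obtain ⟨hun, hpu⟩ := mem_levels.mp hu
  unfold chainDegree
  rw [sum_range_add_single p hun.le, if_pos hsum]
  have hl : levels n (p + Pi.single u 1) = levels n p := by
    ext s
    simp only [mem_levels, Pi.add_apply]
    by_cases h : s = u
    · subst h; simp [hpu]
    · simp [Pi.single_eq_of_ne h]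
  rw [hl, prod_eq_prod_lt_mul_prod_gt hu]
  congr 1
  · congr 1
    · refine Finset.prod_congr rfl fun s hs => ?_
      have hs := (Finset.mem_filter.mp hs).2
      unfold levelWeight
      rw [next_add_single_of_ne_zero (Or.inl hpu), excess_add_single, if_neg (by omega), add_zero,
        Pi.add_apply, Pi.single_eq_of_ne hs.ne, add_zero]
    · unfold levelWeight
      rw [next_add_single_of_ne_zero (Or.inl hpu), excess_add_single, if_pos le_rfl,
        Pi.add_apply, Pi.single_eq_same, Nat.add_sub_cancel]
  · refine Finset.prod_congr rfl fun s hs => ?_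
    have hs := (Finset.mem_filter.mp hs).2
    unfold levelWeight raisedWeight
    rw [next_add_single_of_ne_zero (Or.inl hpu), excess_add_single, if_pos hs.le,
      Pi.add_apply, Pi.single_eq_of_ne hs.ne', add_zero]

theorem chainDegree_add_single_gap {n j u : ℕ} {p : ℕ → ℕ} (hj : j ∈ levels n p)
    (hu : u ∈ Finset.Ioo j (next n p j))
    (hsum : ∑ u ∈ Finset.range (n + 1), p u + 1 = n) :
    chainDegree n (p + Pi.single u 1) = if (u : ℤ) = j + 1 + excess p j then
      (∏ s ∈ levels n p with s < j, levelWeight n p s) *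
      chooseInt (p j - 1) (excess p j) *
      ∏ s ∈ levels n p with j < s, raisedWeight n p s else 0 := by
  obtain ⟨hjn, hpj⟩ := mem_levels.mp hj
  obtain ⟨hju, hu2⟩ := Finset.mem_Ioo.mp hu
  have hun : u < n := hu2.trans_le (next_le p hjn)
  have hpu : p u = 0 := eq_zero_of_lt_next hjn hju hu2
  have hgap : ∀ w, j < w → w < next n p j → p w = 0 := fun w => eq_zero_of_lt_next hjn
  have hl : levels n (p + Pi.single u 1) = insert u (levels n p) := by
    ext s
    simp only [mem_levels, Finset.mem_insert, Pi.add_apply]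
    by_cases h : s = u
    · subst h; simp [hun]
    · simp [h]
  have hul : u ∉ levels n p := fun h => (mem_levels.mp h).2 hpu
  have hex : excess p u = excess p j + j - u := by
    have hs : ∑ v ∈ Finset.range (u + 1), p v = ∑ v ∈ Finset.range (j + 1), p v := by
      refine (Finset.sum_subset (Finset.range_mono (by omega)) fun v hv hv' => ?_).symm
      simp only [Finset.mem_range] at hv hv'
      exact hgap v (by omega) (by omega)
    unfold excess
    rw [hs]
    ring
  have hnu : next n (p + Pi.single u 1) u = next n p j := by
    refine next_eq_of hu2 ?_ ?_
    · rcases next_mem p hjn with h | h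
      · left; simp [h]
      · exact Or.inr h
    · intro w hw hw'
      refine ⟨?_, by have := next_le p hjn; omega⟩
      rw [Pi.add_apply, hgap w (by omega) hw', Pi.single_eq_of_ne (by omega), add_zero]
  have hnj : next n (p + Pi.single u 1) j = u := by
    refine next_eq_of hju (Or.inl (by simp)) ?_
    intro w hw hw'
    refine ⟨?_, by omega⟩
    rw [Pi.add_apply, hgap w hw (by omega), Pi.single_eq_of_ne (by omega), add_zero]
  have hns : ∀ s ∈ levels n p, s ≠ j → next n (p + Pi.single u 1) s = next n p s := by
    intro s hs hsj
    obtain ⟨hsn, hps⟩ := mem_levels.mp hs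
    refine next_eq_of (lt_next p hsn) ?_ ?_
    · rcases next_mem p hsn with h | h
      · left; simp [h]
      · exact Or.inr h
    · intro w hw hw'
      refine ⟨?_, by have := next_le p hsn; omega⟩
      have : w ≠ u := by
        rintro rfl
        rcases lt_or_gt_of_ne hsj with h | h
        · have := next_le_of_mem hsn h hpj
          omega
        · exact hps (hgap s h (by omega))
      rw [Pi.add_apply, eq_zero_of_lt_next hsn hw hw', Pi.single_eq_of_ne this, add_zero]
  unfold chainDegree
  rw [sum_range_add_single p hun.le, if_pos hsum, hl, Finset.prod_insert hul,
    prod_eq_prod_lt_mul_prod_gt hj]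
  have h1 : ∏ s ∈ levels n p with s < j, levelWeight n (p + Pi.single u 1) s =
      ∏ s ∈ levels n p with s < j, levelWeight n p s := by
    refine Finset.prod_congr rfl fun s hs => ?_
    obtain ⟨hs', hs⟩ := Finset.mem_filter.mp hs
    unfold levelWeight
    rw [hns s hs' hs.ne, excess_add_single, if_neg (by omega), add_zero, Pi.add_apply,
      Pi.single_eq_of_ne (by omega), add_zero]
  have h2 : ∏ s ∈ levels n p with j < s, levelWeight n (p + Pi.single u 1) s =
      ∏ s ∈ levels n p with j < s, raisedWeight n p s := by
    refine Finset.prod_congr rfl fun s hs => ?_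
    obtain ⟨hs', hs⟩ := Finset.mem_filter.mp hs
    have hus : u < s := by
      by_contra h
      exact (mem_levels.mp hs').2 (hgap s hs (by omega))
    unfold levelWeight raisedWeight
    rw [hns s hs' hs.ne', excess_add_single, if_pos hus.le, Pi.add_apply,
      Pi.single_eq_of_ne (by omega), add_zero]
  rw [h1, h2]
  have h3 : levelWeight n (p + Pi.single u 1) u = if (u : ℤ) = j + 1 + excess p j then -1 else 0 := by
    unfold levelWeight
    rw [excess_add_single, if_pos le_rfl, hex, Pi.add_apply, hpu, Pi.single_eq_same, hnu]
    split_ifs with h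
    · rw [show excess p j + j - u + 1 = 0 by omega, chooseInt_zero_right, chooseInt_zero_right]
      norm_num
    · rcases lt_or_gt_of_ne h with h | h
      · rw [chooseInt_of_lt (a := 0 + 1 - 1) (by push_cast; omega), zero_mul, neg_zero]
      · rw [chooseInt_of_neg _ (by omega), zero_mul, neg_zero]
  rw [h3]
  split_ifs with h
  · have h4 : levelWeight n (p + Pi.single u 1) j = -chooseInt (p j - 1) (excess p j) := by
      unfold levelWeight
      rw [excess_add_single, if_neg (by omega), hnj, Pi.add_apply, Pi.single_eq_of_ne (by omega),
        add_zero, add_zero, show excess p j = ((u - j - 1 : ℕ) : ℤ) by omega,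
        chooseInt_natCast (u - j - 1), Nat.choose_self]
      simp
    rw [h4]
    ring
  · rw [zero_mul]

/-- The linear relation satisfied by `chainDegree`: `N u` counts the sets of size `u` that contain
a fixed element `e` and are comparable with a given chain of sizes the support of `p`, where `e`
first appears in the member of size `c`. -/
theorem sum_mul_chainDegree_add_single {n c : ℕ} {p : ℕ → ℕ} {N : ℕ → ℤ} (hp0 : p 0 = 1)
    (hsum : ∑ u ∈ Finset.range (n + 1), p u + 1 = n)
    (hc0 : 0 < c) (hcn : c ≤ n) (hc : p c ≠ 0 ∨ c = n) (hNn : N n = 1)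
    (hN : ∀ u ∈ levels n p, N u = if c ≤ u then 1 else 0)
    (hgt : ∀ j ∈ levels n p, c ≤ j → ∀ u ∈ Finset.Ioo j (next n p j),
      N u = (next n p j - j).choose (u - j))
    (heq : ∀ j ∈ levels n p, next n p j = c → ∀ u ∈ Finset.Ioo j (next n p j),
      N u = (next n p j - j - 1).choose (u - j - 1))
    (hlt : ∀ j ∈ levels n p, next n p j < c → ∀ u ∈ Finset.Ioo j (next n p j), N u = 0) :
    ∑ u ∈ Finset.range (n + 1), N u * chainDegree n (p + Pi.single u 1) = 0 := by
  set K := levels n p with hK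
  set V := fun j => ∏ s ∈ K with s < j, levelWeight n p s with hV
  set R := fun j => ∏ s ∈ K with j < s, raisedWeight n p s with hR
  -- the sum over a gap collapses to a single size
  have hgap : ∀ j ∈ K, ∀ M : ℤ → ℤ, (∀ u ∈ Finset.Ioo j (next n p j), N u = M (u - j - 1)) →
      (∀ e : ℤ, e < 0 → chooseInt (p j - 1) e * M e = 0) →
      (∀ e : ℤ, (next n p j : ℤ) - j - 1 < e → M e = 0) →
      ∑ u ∈ Finset.Ioo j (next n p j), N u * chainDegree n (p + Pi.single u 1) =
        M (excess p j) * (V j * chooseInt (p j - 1) (excess p j) * R j) := by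
    intro j hj M hM h1 h2
    obtain ⟨hjn, hpj⟩ := mem_levels.mp hj
    have hjnext := lt_next p hjn
    rw [Finset.sum_congr rfl fun u hu => by
      rw [chainDegree_add_single_gap hj hu hsum, hM u hu]]
    by_cases hin : 0 ≤ excess p j ∧ excess p j + j + 1 < next n p j
    · obtain ⟨k, hk⟩ := Int.eq_ofNat_of_zero_le hin.1
      rw [Finset.sum_eq_single (j + 1 + k)]
      · rw [if_pos (by push_cast; omega)]
        congr 2
        push_cast; omega
      · intro u _ hu
        rw [if_neg (by omega), mul_zero]
      · intro hu
        exact absurd (Finset.mem_Ioo.mpr ⟨by omega, by omega⟩) hu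
    · rw [Finset.sum_eq_zero fun u hu => by
        rw [Finset.mem_Ioo] at hu
        rw [if_neg (by omega), mul_zero]]
      rcases lt_or_ge (excess p j) 0 with hneg | hnn
      · symm
        calc _ = V j * R j * (chooseInt (p j - 1) (excess p j) * M (excess p j)) := by ring
          _ = 0 := by rw [h1 _ hneg, mul_zero]
      · rcases lt_or_ge ((next n p j : ℤ) - j - 1) (excess p j) with hlt' | hge
        · rw [h2 _ hlt', zero_mul]
        · have heq' : excess p j = next n p j - j - 1 := by omega
          have hne : next n p j < n := by
            refine lt_of_le_of_ne (next_le p hjn) fun h => ?_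
            have : ∑ u ∈ Finset.range (j + 1), p u ≤ ∑ u ∈ Finset.range (n + 1), p u :=
              Finset.sum_le_sum_of_subset (Finset.range_mono (by omega))
            unfold excess at heq'
            omega
          have hmem : next n p j ∈ K := by
            refine mem_levels.mpr ⟨hne, ?_⟩
            exact (next_mem p hjn).resolve_right hne.ne
          have hz : R j = 0 := by
            refine Finset.prod_eq_zero (Finset.mem_filter.mpr ⟨hmem, hjnext⟩) ?_
            unfold raisedWeight
            have hex : excess p (next n p j) + 1 = p (next n p j) := by
              have : ∑ v ∈ Finset.range (next n p j), p v =
                  ∑ v ∈ Finset.range (j + 1), p v := by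
                refine (Finset.sum_subset (Finset.range_mono (by omega)) fun v hv hv' => ?_).symm
                simp only [Finset.mem_range] at hv hv'
                exact eq_zero_of_lt_next hjn (by omega) (by omega)
              unfold excess at heq' ⊢
              rw [Finset.sum_range_succ, this]
              push_cast at heq' ⊢
              omega
            have hp := (mem_levels.mp hmem).2
            rw [hex, chooseInt_of_lt (a := p (next n p j) - 1) (by omega), zero_mul, neg_zero]
          rw [hz, mul_zero, mul_zero]
  have hterm : ∀ j ∈ K, c ≤ j →
      N j * chainDegree n (p + Pi.single j 1) +
        ∑ u ∈ Finset.Ioo j (next n p j), N u * chainDegree n (p + Pi.single u 1) =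
      (raisedWeight n p j - levelWeight n p j) * V j * R j := by
    intro j hj hcj
    obtain ⟨hjn, hpj⟩ := mem_levels.mp hj
    have hjnext := lt_next p hjn
    rw [hgap j hj (fun e => chooseInt (next n p j - j) (e + 1)), hN j hj, if_pos hcj, one_mul,
      chainDegree_add_single_level hj hsum]
    · obtain ⟨d, hd⟩ := Nat.exists_eq_succ_of_ne_zero hpj
      obtain ⟨g, hg⟩ := Nat.exists_eq_succ_of_ne_zero (show next n p j - j ≠ 0 by omega)
      unfold raisedWeight levelWeight
      rw [hd, hg, Nat.succ_sub_one, Nat.succ_sub_one, Nat.succ_eq_add_one, Nat.succ_eq_add_one,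
        chooseInt_succ, chooseInt_succ]
      simp only [hV, hR, hK, levelWeight, raisedWeight]
      ring
    · intro u hu
      rw [hgt j hj hcj u hu, ← chooseInt_natCast]
      congr 1
      rw [Finset.mem_Ioo] at hu
      omega
    · intro e he
      rw [chooseInt_of_neg _ he, zero_mul]
    · intro e he
      exact chooseInt_of_lt (by omega)
  have hterm_eq : ∀ j ∈ K, next n p j = c →
      N j * chainDegree n (p + Pi.single j 1) +
        ∑ u ∈ Finset.Ioo j (next n p j), N u * chainDegree n (p + Pi.single u 1) =
      -(levelWeight n p j * V j * R j) := by
    intro j hj hcj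
    obtain ⟨hjn, hpj⟩ := mem_levels.mp hj
    have hjnext := lt_next p hjn
    rw [hgap j hj (fun e => chooseInt (next n p j - j - 1) e), hN j hj, if_neg (by omega)]
    · unfold levelWeight
      ring
    · intro u hu
      rw [heq j hj hcj u hu, ← chooseInt_natCast]
      congr 1
      rw [Finset.mem_Ioo] at hu
      omega
    · intro e he
      rw [chooseInt_of_neg _ he, zero_mul]
    · intro e he
      exact chooseInt_of_lt (by omega)
  have hterm_lt : ∀ j ∈ K, next n p j < c →
      N j * chainDegree n (p + Pi.single j 1) +
        ∑ u ∈ Finset.Ioo j (next n p j), N u * chainDegree n (p + Pi.single u 1) = 0 := by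
    intro j hj hcj
    have hjnext := lt_next p (mem_levels.mp hj).1
    rw [hN j hj, if_neg (by omega), zero_mul, zero_add]
    exact Finset.sum_eq_zero fun u hu => by rw [hlt j hj hcj u hu, zero_mul]
  -- the last level below `c`
  obtain ⟨a, haK, hac, hanext⟩ : ∃ a ∈ K, a < c ∧ next n p a = c := by
    have hne : (K.filter (· < c)).Nonempty :=
      ⟨0, Finset.mem_filter.mpr ⟨mem_levels.mpr ⟨by omega, by omega⟩, hc0⟩⟩
    obtain ⟨a, ha, hmax⟩ := Finset.exists_max_image _ id hne
    obtain ⟨haK, hac⟩ := Finset.mem_filter.mp ha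
    refine ⟨a, haK, hac, next_eq_of hac hc fun w hw hwc => ⟨?_, by omega⟩⟩
    by_contra hpw
    have := hmax w (Finset.mem_filter.mpr ⟨mem_levels.mpr ⟨by omega, hpw⟩, hwc⟩)
    simp only [id] at this
    omega
  have hVa : ∏ s ∈ K with s < c, levelWeight n p s = V a * levelWeight n p a := by
    have : K.filter (· < c) = insert a (K.filter (· < a)) := by
      ext s
      simp only [Finset.mem_filter, Finset.mem_insert]
      constructor
      · rintro ⟨hs, hsc⟩
        rcases lt_trichotomy s a with h | h | h
        · exact Or.inr ⟨hs, h⟩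
        · exact Or.inl h
        · have := next_le_of_mem (mem_levels.mp haK).1 h (mem_levels.mp hs).2
          omega
      · rintro (rfl | ⟨hs, h⟩)
        · exact ⟨haK, hac⟩
        · exact ⟨hs, h.trans hac⟩
    rw [this, Finset.prod_insert (by simp), mul_comm]
  have hfilter : ∀ j ∈ K, c ≤ j → V j = (V a * levelWeight n p a) *
      ∏ s ∈ K.filter (c ≤ ·) with s < j, levelWeight n p s := by
    intro j hj hcj
    rw [← hVa, hV]
    simp only
    rw [← Finset.prod_filter_mul_prod_filter_not _ (· < c), Finset.filter_filter,
      Finset.filter_filter, Finset.filter_filter]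
    congr 1
    · refine Finset.prod_congr (Finset.filter_congr fun s _ => ?_) fun _ _ => rfl
      omega
    · refine Finset.prod_congr (Finset.filter_congr fun s _ => ?_) fun _ _ => rfl
      omega
  have hRa : R a = ∏ s ∈ K.filter (c ≤ ·), raisedWeight n p s := by
    refine Finset.prod_congr (Finset.filter_congr fun s hs => ?_) fun _ _ => rfl
    constructor
    · intro h
      have := next_le_of_mem (mem_levels.mp haK).1 h (mem_levels.mp hs).2
      omega
    · intro h; omega
  have hsumge : ∑ j ∈ K.filter (c ≤ ·),
      (raisedWeight n p j - levelWeight n p j) * V j * R j =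
      (V a * levelWeight n p a) * (∏ s ∈ K.filter (c ≤ ·), raisedWeight n p s -
        ∏ s ∈ K.filter (c ≤ ·), levelWeight n p s) := by
    have h := Finset.prod_add_ordered (K.filter (c ≤ ·)) (raisedWeight n p)
      (fun s => levelWeight n p s - raisedWeight n p s)
    simp only [add_sub_cancel] at h
    rw [h, sub_add_cancel_left, mul_neg, Finset.mul_sum, ← Finset.sum_neg_distrib]
    refine Finset.sum_congr rfl fun j hj => ?_
    obtain ⟨hjK, hcj⟩ := Finset.mem_filter.mp hj
    rw [hfilter j hjK hcj]
    have : R j = ∏ s ∈ K.filter (c ≤ ·) with j < s, raisedWeight n p s := by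
      rw [Finset.filter_filter]
      refine Finset.prod_congr (Finset.filter_congr fun s _ => ?_) fun _ _ => rfl
      omega
    rw [this]
    ring
  have hsumlt : ∑ j ∈ K.filter (fun j => ¬ c ≤ j),
      (N j * chainDegree n (p + Pi.single j 1) +
        ∑ u ∈ Finset.Ioo j (next n p j), N u * chainDegree n (p + Pi.single u 1)) =
      -(levelWeight n p a * V a * R a) := by
    rw [Finset.sum_eq_single a, hterm_eq a haK hanext]
    · intro j hj hja
      obtain ⟨hjK, hcj⟩ := Finset.mem_filter.mp hj
      refine hterm_lt j hjK ?_
      have hjn := (mem_levels.mp hjK).1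
      have hle : next n p j ≤ c := (next_isLeast p hjn).2 ⟨by omega, hc⟩
      refine lt_of_le_of_ne hle fun h => ?_
      rcases lt_or_gt_of_ne hja with h' | h'
      · have := next_le_of_mem hjn h' (mem_levels.mp haK).2
        omega
      · have := next_le_of_mem (mem_levels.mp haK).1 h' (mem_levels.mp hjK).2
        omega
    · intro h
      exact absurd (Finset.mem_filter.mpr ⟨haK, by omega⟩) h
  have hall : ∏ s ∈ K, levelWeight n p s =
      (V a * levelWeight n p a) * ∏ s ∈ K.filter (c ≤ ·), levelWeight n p s := by
    rw [← hVa, ← Finset.prod_filter_mul_prod_filter_not K (· < c)]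
    simp only [not_lt]
  rw [Finset.sum_range_succ, hNn, one_mul, chainDegree_add_single_top hsum,
    sum_range_eq_sum_levels (p := p) (by omega), ← Finset.sum_filter_add_sum_filter_not K (c ≤ ·),
    hsumlt, Finset.sum_congr rfl fun j hj => hterm j (Finset.mem_filter.mp hj).1
      (Finset.mem_filter.mp hj).2, hsumge, hRa, hall]
  ring

theorem card_filter_between {α : Type*} [Fintype α] [DecidableEq α] {A B : Finset α} (hAB : A ⊆ B)
    {u : ℕ} (hu : A.card ≤ u) :
    (Finset.univ.filter fun S : Finset α => A ⊆ S ∧ S ⊆ B ∧ S.card = u).card =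
      (B.card - A.card).choose (u - A.card) := by
  rw [← Finset.card_sdiff_of_subset hAB, ← Finset.card_powersetCard]
  refine Finset.card_nbij' (fun S => S \ A) (fun S => S ∪ A) ?_ ?_ ?_ ?_
  · intro S hS
    obtain ⟨-, h1, h2, h3⟩ := Finset.mem_filter.mp hS
    refine Finset.mem_powersetCard.mpr ⟨Finset.sdiff_subset_sdiff h2 le_rfl, ?_⟩
    rw [Finset.card_sdiff_of_subset h1, h3]
  · intro S hS
    obtain ⟨h1, h2⟩ := Finset.mem_powersetCard.mp hS
    refine Finset.mem_filter.mpr ⟨Finset.mem_univ _, Finset.subset_union_right,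
      Finset.union_subset (h1.trans Finset.sdiff_subset) hAB, ?_⟩
    rw [Finset.card_union_of_disjoint, h2]
    · omega
    · exact Finset.disjoint_of_subset_left h1 Finset.sdiff_disjoint
  · intro S hS
    obtain ⟨-, h1, h2, h3⟩ := Finset.mem_filter.mp hS
    exact Finset.sdiff_union_of_subset h1
  · intro S hS
    obtain ⟨h1, h2⟩ := Finset.mem_powersetCard.mp hS
    refine Finset.union_sdiff_cancel_right ?_
    exact Finset.disjoint_of_subset_left h1 Finset.sdiff_disjoint

variable {n : ℕ}

theorem sum_nonemptySubset {M : Type*} [AddCommMonoid M] (f : Finset (Fin n) → M) (h : f ∅ = 0) :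
    ∑ S : NonemptySubset n, f S.1 = ∑ S : Finset (Fin n), f S := by
  rw [← Finset.sum_subtype (Finset.univ.filter fun S : Finset (Fin n) => S.Nonempty)
    (fun S => by simp) f]
  refine Finset.sum_subset (Finset.filter_subset _ _) fun S _ hS => ?_
  have : S = ∅ := by simpa using hS
  rw [this, h]

/-- The exponents of a monomial by size of the subset, with exponent `1` at size `0`. -/
noncomputable def sizes (m : NonemptySubset n →₀ ℕ) : ℕ → ℕ :=
  fun u => (Pi.single 0 1 : ℕ → ℕ) u + ∑ S : NonemptySubset n with S.1.card = u, m S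

theorem sizes_zero (m : NonemptySubset n →₀ ℕ) : sizes m 0 = 1 := by
  unfold sizes
  rw [Pi.single_eq_same, Finset.sum_eq_zero, add_zero]
  intro S hS
  exact absurd (Finset.mem_filter.mp hS).2 (Finset.card_pos.mpr S.2).ne'

theorem sizes_ne_zero_iff {m : NonemptySubset n →₀ ℕ} {u : ℕ} (hu : 0 < u) :
    sizes m u ≠ 0 ↔ ∃ S ∈ m.support, S.1.card = u := by
  unfold sizes
  rw [Pi.single_eq_of_ne hu.ne', zero_add, Ne, Finset.sum_eq_zero_iff]
  push Not
  simp only [Finset.mem_filter, Finset.mem_univ, true_and, Finsupp.mem_support_iff]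
  exact exists_congr fun S => and_comm

theorem sizes_add_single (m : NonemptySubset n →₀ ℕ) (S : NonemptySubset n) :
    sizes (m + Finsupp.single S 1) = sizes m + Pi.single S.1.card 1 := by
  ext u
  unfold sizes
  simp only [Finsupp.coe_add, Pi.add_apply, Finset.sum_add_distrib, add_assoc]
  congr 2
  simp only [Finsupp.single_apply, Finset.sum_ite_eq, Finset.mem_filter, Finset.mem_univ, true_and,
    Pi.single_apply, eq_comm]

/-- The support of `m` is a chain of subsets. -/
def IsFlag (m : NonemptySubset n →₀ ℕ) : Prop :=
  ∀ S ∈ m.support, ∀ T ∈ m.support, S.1 ⊆ T.1 ∨ T.1 ⊆ S.1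

instance (m : NonemptySubset n →₀ ℕ) : Decidable (IsFlag m) :=
  inferInstanceAs (Decidable (∀ S ∈ m.support, ∀ T ∈ m.support, S.1 ⊆ T.1 ∨ T.1 ⊆ S.1))

/-- `S` is comparable with all sets in the support of `m`. -/
def Compatible (m : NonemptySubset n →₀ ℕ) (S : Finset (Fin n)) : Prop :=
  ∀ T ∈ m.support, S ⊆ T.1 ∨ T.1 ⊆ S

instance (m : NonemptySubset n →₀ ℕ) (S : Finset (Fin n)) : Decidable (Compatible m S) :=
  inferInstanceAs (Decidable (∀ T ∈ m.support, S ⊆ T.1 ∨ T.1 ⊆ S))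

theorem isFlag_add_single {m : NonemptySubset n →₀ ℕ} {S : NonemptySubset n} :
    IsFlag (m + Finsupp.single S 1) ↔ IsFlag m ∧ Compatible m S.1 := by
  have hsupp : ∀ T, T ∈ (m + Finsupp.single S 1).support ↔ T ∈ m.support ∨ T = S := by
    intro T
    simp only [Finsupp.mem_support_iff, Finsupp.coe_add, Pi.add_apply, Finsupp.single_apply]
    by_cases h : S = T
    · simp [h]
    · simp [h, Ne.symm h]
  constructor
  · intro h
    exact ⟨fun T hT U hU => h T ((hsupp T).mpr (Or.inl hT)) U ((hsupp U).mpr (Or.inl hU)),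
      fun T hT => h S ((hsupp S).mpr (Or.inr rfl)) T ((hsupp T).mpr (Or.inl hT))⟩
  · rintro ⟨h1, h2⟩ T hT U hU
    rcases (hsupp T).mp hT with hT' | rfl <;> rcases (hsupp U).mp hU with hU' | rfl
    · exact h1 T hT' U hU'
    · exact (h2 T hT').symm
    · exact h2 U hU'
    · exact Or.inl subset_rfl

/-- The degree of a monomial, up to a global sign. -/
noncomputable def monomialDegree (m : NonemptySubset n →₀ ℕ) : ℤ :=
  if IsFlag m then chainDegree n (sizes m) else 0

/-- The union of the members of size at most `u` of the support of `m`, and `[n]` for `u ≥ n`. -/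
def member (m : NonemptySubset n →₀ ℕ) (u : ℕ) : Finset (Fin n) :=
  if n ≤ u then Finset.univ else (m.support.filter fun S => S.1.card ≤ u).sup Subtype.val

theorem member_mono (m : NonemptySubset n →₀ ℕ) {u v : ℕ} (h : u ≤ v) :
    member m u ⊆ member m v := by
  unfold member
  split_ifs with h1 h2
  · exact subset_rfl
  · omega
  · exact Finset.subset_univ _
  · exact Finset.sup_mono fun S hS => by
      rw [Finset.mem_filter] at hS ⊢
      exact ⟨hS.1, hS.2.trans h⟩

theorem member_top (m : NonemptySubset n →₀ ℕ) : member m n = Finset.univ := if_pos le_rfl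

theorem member_zero (m : NonemptySubset n →₀ ℕ) (hn : 0 < n) : member m 0 = ∅ := by
  unfold member
  rw [if_neg (by omega), Finset.filter_eq_empty_iff.mpr, Finset.sup_empty, Finset.bot_eq_empty]
  intro S _
  have := Finset.card_pos.mpr S.2
  omega

theorem IsFlag.member_card {m : NonemptySubset n →₀ ℕ} (hm : IsFlag m) {T : NonemptySubset n}
    (hT : T ∈ m.support) : member m T.1.card = T.1 := by
  unfold member
  split_ifs with h
  · refine (Finset.eq_univ_of_card _ ?_).symm
    have := Finset.card_le_univ T.1
    rw [Fintype.card_fin] at *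
    omega
  · refine le_antisymm (Finset.sup_le fun S hS => ?_)
      (Finset.le_sup (f := Subtype.val) (Finset.mem_filter.mpr ⟨hT, le_rfl⟩))
    rw [Finset.mem_filter] at hS
    rcases hm S hS.1 T hT with h' | h'
    · exact h'
    · exact (Finset.eq_of_subset_of_card_le h' hS.2).ge

theorem IsFlag.card_member {m : NonemptySubset n →₀ ℕ} (hm : IsFlag m) (hn : 0 < n) {u : ℕ}
    (hu : sizes m u ≠ 0 ∨ u = n) : (member m u).card = u := by
  rcases Nat.eq_zero_or_pos u with rfl | hpos
  · rw [member_zero m hn, Finset.card_empty]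
  rcases hu with hu | rfl
  · obtain ⟨T, hT, rfl⟩ := (sizes_ne_zero_iff hpos).mp hu
    rw [hm.member_card hT]
  · rw [member_top, Finset.card_univ, Fintype.card_fin]

theorem IsFlag.compatible_iff_eq_member {m : NonemptySubset n →₀ ℕ} (hm : IsFlag m)
    {S : Finset (Fin n)} (hS : S.Nonempty) (hu : sizes m S.card ≠ 0) :
    Compatible m S ↔ S = member m S.card := by
  obtain ⟨T, hT, hTS⟩ := (sizes_ne_zero_iff (Finset.card_pos.mpr hS)).mp hu
  rw [← hTS, hm.member_card hT]
  constructor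
  · intro h
    rcases h T hT with h | h
    · exact Finset.eq_of_subset_of_card_le h hTS.le
    · exact (Finset.eq_of_subset_of_card_le h hTS.ge).symm
  · rintro rfl
    exact fun U hU => hm T hT U hU

theorem IsFlag.compatible_iff_between {m : NonemptySubset n →₀ ℕ} (hm : IsFlag m) {j : ℕ}
    (hj : j ∈ levels n (sizes m)) {S : Finset (Fin n)}
    (hS : S.card ∈ Finset.Ioo j (next n (sizes m) j)) :
    Compatible m S ↔ member m j ⊆ S ∧ S ⊆ member m (next n (sizes m) j) := by
  obtain ⟨hjn, hpj⟩ := mem_levels.mp hj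
  obtain ⟨h1, h2⟩ := Finset.mem_Ioo.mp hS
  constructor
  · intro h
    constructor
    · rcases Nat.eq_zero_or_pos j with rfl | hpos
      · rw [member_zero m hjn]; exact Finset.empty_subset _
      · obtain ⟨T, hT, rfl⟩ := (sizes_ne_zero_iff hpos).mp hpj
        rw [hm.member_card hT]
        exact (h T hT).resolve_left fun h' => by
          have := Finset.card_le_card h'
          omega
    · rcases next_mem (sizes m) hjn with h' | h'
      · obtain ⟨T, hT, hTc⟩ := (sizes_ne_zero_iff (by omega)).mp h'
        rw [← hTc, hm.member_card hT]
        exact (h T hT).resolve_right fun h'' => by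
          have := Finset.card_le_card h''
          omega
      · rw [h', member_top]; exact Finset.subset_univ _
  · rintro ⟨hl, hr⟩ T hT
    have hTp : sizes m T.1.card ≠ 0 :=
      (sizes_ne_zero_iff (Finset.card_pos.mpr T.2)).mpr ⟨T, hT, rfl⟩
    rw [← hm.member_card hT]
    rcases le_or_gt T.1.card j with h | h
    · exact Or.inr ((member_mono m h).trans hl)
    · exact Or.inl (hr.trans (member_mono m (next_le_of_mem hjn h hTp)))

theorem IsFlag.sum_monomialDegree_add_single_eq {m : NonemptySubset n →₀ ℕ} (hm : IsFlag m)
    (e : Fin n) :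
    ∑ S : NonemptySubset n with e ∈ S.1, monomialDegree (m + Finsupp.single S 1) =
      ∑ u ∈ Finset.range (n + 1), ((Finset.univ.filter fun S : Finset (Fin n) =>
        e ∈ S ∧ Compatible m S ∧ S.card = u).card : ℤ) *
        chainDegree n (sizes m + Pi.single u 1) := by
  let g : Finset (Fin n) → ℤ := fun S =>
    if e ∈ S ∧ Compatible m S then chainDegree n (sizes m + Pi.single S.card 1) else 0
  have h1 : ∀ S : NonemptySubset n,
      (if e ∈ S.1 then monomialDegree (m + Finsupp.single S 1) else 0) = g S.1 := by
    intro S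
    simp only [g, monomialDegree, sizes_add_single, isFlag_add_single, hm, true_and, ite_and]
  rw [Finset.sum_filter, Finset.sum_congr rfl fun S _ => h1 S, sum_nonemptySubset g (by simp [g]),
    ← Finset.sum_filter, ← Finset.sum_fiberwise_of_maps_to (g := Finset.card)
      (t := Finset.range (n + 1)) fun S _ => Finset.mem_range.mpr
        (Nat.lt_succ_of_le (by simpa using Finset.card_le_univ S))]
  refine Finset.sum_congr rfl fun u _ => ?_
  rw [Finset.filter_filter, Finset.sum_congr rfl fun S hS => by
    rw [(Finset.mem_filter.mp hS).2.2], Finset.sum_const, nsmul_eq_mul]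
  simp only [and_assoc]

theorem sum_monomialDegree_add_single (m : NonemptySubset n →₀ ℕ) (e : Fin n) :
    ∑ S : NonemptySubset n with e ∈ S.1, monomialDegree (m + Finsupp.single S 1) = 0 := by
  have hn : 0 < n := e.pos
  by_cases hm : IsFlag m
  swap
  · refine Finset.sum_eq_zero fun S _ => if_neg fun h => hm (isFlag_add_single.mp h).1
  have hcard : ∀ S : Finset (Fin n), S.card ≤ n := fun S => by
    simpa using Finset.card_le_univ S
  by_cases hsum : ∑ u ∈ Finset.range (n + 1), sizes m u + 1 = n
  swap
  · refine Finset.sum_eq_zero fun S _ => ?_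
    unfold monomialDegree chainDegree
    rw [sizes_add_single, sum_range_add_single _ (hcard _), if_neg hsum, ite_self]
  set N : ℕ → ℤ := fun u => ((Finset.univ.filter fun S : Finset (Fin n) =>
    e ∈ S ∧ Compatible m S ∧ S.card = u).card : ℤ) with hN
  rw [hm.sum_monomialDegree_add_single_eq e]
  have hex : ∃ c, (sizes m c ≠ 0 ∨ c = n) ∧ e ∈ member m c :=
    ⟨n, Or.inr rfl, by rw [member_top]; exact Finset.mem_univ e⟩
  set c := Nat.find hex with hcdef
  obtain ⟨hc, hec⟩ := Nat.find_spec hex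
  rw [← hcdef] at hc hec
  have hmem : ∀ s, (sizes m s ≠ 0 ∨ s = n) → (e ∈ member m s ↔ c ≤ s) := fun s hs =>
    ⟨fun h => Nat.find_min' hex ⟨hs, h⟩, fun h => member_mono m h hec⟩
  have hc0 : 0 < c := by
    refine Nat.pos_of_ne_zero fun h => ?_
    rw [h, member_zero m hn] at hec
    exact Finset.notMem_empty _ hec
  have hcn : c ≤ n := (hmem n (Or.inr rfl)).mp (by rw [member_top]; exact Finset.mem_univ e)
  have hcm : ∀ s, (sizes m s ≠ 0 ∨ s = n) → (member m s).card = s := fun s hs => hm.card_member hn hs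
  have hbetween : ∀ j ∈ levels n (sizes m), ∀ u ∈ Finset.Ioo j (next n (sizes m) j),
      N u = ((Finset.univ.filter fun S : Finset (Fin n) =>
        insert e (member m j) ⊆ S ∧ S ⊆ member m (next n (sizes m) j) ∧ S.card = u).card : ℤ) := by
    intro j hj u hu
    simp only [hN]
    congr 2
    refine Finset.filter_congr fun S _ => ?_
    rw [Finset.insert_subset_iff]
    constructor
    · rintro ⟨he, hS, rfl⟩
      have := (hm.compatible_iff_between hj hu).mp hS
      exact ⟨⟨he, this.1⟩, this.2, rfl⟩
    · rintro ⟨⟨he, h1⟩, h2, rfl⟩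
      exact ⟨he, (hm.compatible_iff_between hj hu).mpr ⟨h1, h2⟩, rfl⟩
  refine sum_mul_chainDegree_add_single (c := c) (N := N) (sizes_zero m) hsum hc0 hcn hc ?_ ?_ ?_ ?_ ?_
  · have : (Finset.univ.filter fun S : Finset (Fin n) =>
        e ∈ S ∧ Compatible m S ∧ S.card = n) = {Finset.univ} := by
      ext S
      simp only [Finset.mem_filter, Finset.mem_univ, true_and, Finset.mem_singleton]
      constructor
      · rintro ⟨-, -, h⟩
        exact Finset.eq_univ_of_card _ (by simpa using h)
      · rintro rfl
        exact ⟨Finset.mem_univ _, fun T _ => Or.inr (Finset.subset_univ _), by simp⟩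
    simp only [hN, this, Finset.card_singleton, Nat.cast_one]
  · intro u hu
    obtain ⟨hun, hpu⟩ := mem_levels.mp hu
    have : (Finset.univ.filter fun S : Finset (Fin n) =>
        e ∈ S ∧ Compatible m S ∧ S.card = u) = if c ≤ u then {member m u} else ∅ := by
      ext S
      simp only [Finset.mem_filter, Finset.mem_univ, true_and]
      constructor
      · rintro ⟨he, hS, rfl⟩
        have h := (hm.compatible_iff_eq_member ⟨e, he⟩ hpu).mp hS
        rw [if_pos ((hmem _ (Or.inl hpu)).mp (h ▸ he))]
        exact Finset.mem_singleton.mpr h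
      · split_ifs with hcu
        · intro h
          rw [Finset.mem_singleton] at h
          have he : e ∈ S := h ▸ (hmem _ (Or.inl hpu)).mpr hcu
          have hSc : S.card = u := h ▸ hcm u (Or.inl hpu)
          refine ⟨he, ?_, hSc⟩
          subst hSc
          exact (hm.compatible_iff_eq_member ⟨e, he⟩ hpu).mpr h
        · intro h; exact absurd h (Finset.notMem_empty _)
    simp only [hN, this]
    split_ifs <;> simp
  · intro j hj hcj u hu
    obtain ⟨hjn, hpj⟩ := mem_levels.mp hj
    have hju := (Finset.mem_Ioo.mp hu).1
    rw [hbetween j hj u hu, Finset.insert_eq_of_mem ((hmem j (Or.inl hpj)).mpr hcj),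
      card_filter_between (member_mono m (lt_next (sizes m) hjn).le) (by rw [hcm j (Or.inl hpj)]; omega),
      hcm j (Or.inl hpj), hcm _ (next_mem (sizes m) hjn)]
  · intro j hj hcj u hu
    obtain ⟨hjn, hpj⟩ := mem_levels.mp hj
    have hju := (Finset.mem_Ioo.mp hu).1
    have hlt := lt_next (sizes m) hjn
    have hej : e ∉ member m j := fun h => by
      have := (hmem j (Or.inl hpj)).mp h
      omega
    have hcard' : (insert e (member m j)).card = j + 1 := by
      rw [Finset.card_insert_of_notMem hej, hcm j (Or.inl hpj)]
    rw [hbetween j hj u hu, card_filter_between (Finset.insert_subset (hcj ▸ hec)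
      (member_mono m hlt.le)) (by omega), hcard', hcm _ (next_mem (sizes m) hjn), Nat.sub_sub, Nat.sub_sub]
  · intro j hj hcj u hu
    obtain ⟨hjn, hpj⟩ := mem_levels.mp hj
    rw [hbetween j hj u hu, Finset.filter_eq_empty_iff.mpr, Finset.card_empty, Nat.cast_zero]
    rintro S - ⟨h1, h2, -⟩
    have := (hmem _ (next_mem (sizes m) hjn)).mp (h2 (h1 (Finset.mem_insert_self _ _)))
    omega

theorem x_mul_x_eq_zero {S T : NonemptySubset n} (h1 : ¬ S.1 ⊆ T.1) (h2 : ¬ T.1 ⊆ S.1) :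
    x S * x T = 0 := by
  unfold x
  rw [← map_mul, Ideal.Quotient.eq_zero_iff_mem]
  exact Ideal.mem_sup_left (Ideal.subset_span ⟨S, T, h1, h2, rfl⟩)

theorem sum_x_eq_zero (e : Fin n) : ∑ S : NonemptySubset n with e ∈ S.1, x S = 0 := by
  unfold x
  rw [← map_sum, Ideal.Quotient.eq_zero_iff_mem]
  exact Ideal.mem_sup_right (Ideal.subset_span ⟨e, rfl⟩)

theorem x_mul_x_eq_zero_of_card_eq {S T : NonemptySubset n} (h : S ≠ T)
    (hc : S.1.card = T.1.card) : x S * x T = 0 :=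
  x_mul_x_eq_zero (fun h' => h (Subtype.ext (Finset.eq_of_subset_of_card_le h' hc.ge)))
    (fun h' => h (Subtype.ext (Finset.eq_of_subset_of_card_le h' hc.le).symm))

theorem z_pow_succ (s k : ℕ) :
    z n s ^ (k + 1) = ∑ S : NonemptySubset n with S.1.card = s, x S ^ (k + 1) := by
  induction k with
  | zero => simp [z]
  | succ k ih =>
    rw [pow_succ, ih, z, Finset.sum_mul_sum]
    refine Finset.sum_congr rfl fun S hS => ?_
    rw [Finset.sum_eq_single S, pow_succ _ (k + 1)]
    · intro T hT hTS
      rw [pow_succ, mul_assoc, x_mul_x_eq_zero_of_card_eq hTS.symm, mul_zero]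
      rw [(Finset.mem_filter.mp hS).2, (Finset.mem_filter.mp hT).2]
    · intro h; exact absurd hS h

theorem z_pow {s k : ℕ} (hk : k ≠ 0) :
    z n s ^ k = ∑ S : NonemptySubset n with S.1.card = s, x S ^ k := by
  obtain ⟨k, rfl⟩ := Nat.exists_eq_succ_of_ne_zero hk
  exact z_pow_succ s k

/-- The linear extension of `monomialDegree` to polynomials. -/
noncomputable def polynomialDegree (n : ℕ) : MvPolynomial (NonemptySubset n) ℤ →ₗ[ℤ] ℤ :=
  (MvPolynomial.basisMonomials (NonemptySubset n) ℤ).constr ℤ monomialDegree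

theorem polynomialDegree_monomial (m : NonemptySubset n →₀ ℕ) :
    polynomialDegree n (MvPolynomial.monomial m 1) = monomialDegree m := by
  have := (MvPolynomial.basisMonomials (NonemptySubset n) ℤ).constr_basis ℤ monomialDegree m
  rwa [MvPolynomial.coe_basisMonomials] at this

theorem polynomialDegree_mul_eq_zero {g : MvPolynomial (NonemptySubset n) ℤ}
    (h : ∀ m, polynomialDegree n (MvPolynomial.monomial m 1 * g) = 0)
    (f : MvPolynomial (NonemptySubset n) ℤ) : polynomialDegree n (f * g) = 0 := by
  induction f using MvPolynomial.induction_on' with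
  | monomial m a =>
    have : (MvPolynomial.monomial m a : MvPolynomial (NonemptySubset n) ℤ) =
        a • MvPolynomial.monomial m 1 := by
      rw [MvPolynomial.smul_monomial, smul_eq_mul, mul_one]
    rw [this, smul_mul_assoc, map_smul, h, smul_zero]
  | add p q hp hq => rw [add_mul, map_add, hp, hq, add_zero]

theorem polynomialDegree_eq_zero_of_mem {f : MvPolynomial (NonemptySubset n) ℤ}
    (hf : f ∈ chowIdeal n) : polynomialDegree n f = 0 := by
  rw [chowIdeal, ← Ideal.span_union] at hf
  refine Submodule.span_induction (p := fun f _ => ∀ g, polynomialDegree n (g * f) = 0)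
    ?_ ?_ ?_ ?_ hf 1 |> fun h => by rwa [one_mul] at h
  · rintro f (⟨S, T, h1, h2, rfl⟩ | ⟨e, rfl⟩)
    · refine polynomialDegree_mul_eq_zero fun m => ?_
      rw [MvPolynomial.X, MvPolynomial.X, MvPolynomial.monomial_mul, MvPolynomial.monomial_mul,
        one_mul, one_mul, polynomialDegree_monomial, ← add_assoc]
      refine if_neg fun h => ?_
      obtain ⟨h3, h4⟩ := isFlag_add_single.mp h
      rcases h4 S (by simp) with h5 | h5
      · exact h2 h5
      · exact h1 h5
    · refine polynomialDegree_mul_eq_zero fun m => ?_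
      rw [Finset.mul_sum, map_sum, ← sum_monomialDegree_add_single m e]
      refine Finset.sum_congr rfl fun S _ => ?_
      rw [MvPolynomial.X, MvPolynomial.monomial_mul, one_mul, polynomialDegree_monomial]
  · simp
  · intro f g _ _ hf hg a
    rw [mul_add, map_add, hf, hg, add_zero]
  · intro a f _ hf b
    rw [smul_eq_mul, ← mul_assoc, hf]

/-- The degree map of the permutahedral Chow ring, up to a global sign. -/
noncomputable def degree (n : ℕ) : PermChow n →+ ℤ :=
  QuotientAddGroup.lift (chowIdeal n).toAddSubgroup (polynomialDegree n).toAddMonoidHom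
    fun _ hf => polynomialDegree_eq_zero_of_mem hf

theorem degree_mk (f : MvPolynomial (NonemptySubset n) ℤ) :
    degree n (Ideal.Quotient.mk (chowIdeal n) f) = polynomialDegree n f := rfl

/-- The monomial exponent with `r s` at the set `f s`. -/
noncomputable def flagExponent (r : ℕ →₀ ℕ) (f : r.support → NonemptySubset n) :
    NonemptySubset n →₀ ℕ :=
  ∑ s : r.support, Finsupp.single (f s) (r s)

theorem sizes_flagExponent {r : ℕ →₀ ℕ} {f : r.support → NonemptySubset n}
    (hf : ∀ s, (f s).1.card = s) : sizes (flagExponent r f) = Pi.single 0 1 + ⇑r := by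
  ext u
  unfold sizes flagExponent
  rw [Pi.add_apply]
  congr 1
  simp only [Finsupp.coe_finsetSum, Finset.sum_apply]
  rw [Finset.sum_comm]
  simp only [Finsupp.single_apply, Finset.sum_ite_eq, Finset.mem_filter, Finset.mem_univ, true_and,
    hf]
  rw [Finset.sum_coe_sort r.support (fun s => if s = u then r s else 0), Finset.sum_ite_eq']
  split_ifs with h
  · rfl
  · exact (Finsupp.notMem_support_iff.mp h).symm

theorem zMonomial_eq_sum (r : ℕ →₀ ℕ) :
    zMonomial n r = ∑ f ∈ Fintype.piFinset fun s : r.support =>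
        Finset.univ.filter fun S : NonemptySubset n => S.1.card = s,
      Ideal.Quotient.mk (chowIdeal n) (MvPolynomial.monomial (flagExponent r f) 1) := by
  unfold zMonomial
  rw [← Finset.prod_coe_sort, Finset.prod_congr rfl fun s _ =>
    z_pow (Finsupp.mem_support_iff.mp s.2), Finset.prod_univ_sum]
  refine Finset.sum_congr rfl fun f _ => ?_
  unfold flagExponent x
  rw [MvPolynomial.monomial_sum_one, map_prod]
  refine Finset.prod_congr rfl fun s _ => ?_
  rw [← map_pow, MvPolynomial.X_pow_eq_monomial]

theorem degree_zMonomial {r : ℕ →₀ ℕ} (hr : r.support ⊆ Finset.Icc 1 n) :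
    ∃ N : ℕ, N ≠ 0 ∧
      degree n (zMonomial n r) = N * chainDegree n (Pi.single 0 1 + ⇑r) := by
  set F := Fintype.piFinset fun s : r.support =>
        Finset.univ.filter fun S : NonemptySubset n => S.1.card = s with hF
  have hmem : ∀ f, f ∈ F ↔ ∀ s, (f s).1.card = s := fun f => by
    simp [hF, Fintype.mem_piFinset]
  refine ⟨(F.filter fun f => IsFlag (flagExponent r f)).card, ?_, ?_⟩
  · have hcard : ∀ s : r.support,
        (Finset.univ.filter fun i : Fin n => (i : ℕ) < s).card = s := fun s => by
      have := Finset.mem_Icc.mp (hr s.2)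
      rw [Fin.card_filter_val_lt]
      omega
    let f : r.support → NonemptySubset n := fun s =>
      ⟨Finset.univ.filter fun i : Fin n => (i : ℕ) < s, by
        rw [← Finset.card_pos, hcard]
        exact (Finset.mem_Icc.mp (hr s.2)).1⟩
    refine Finset.card_ne_zero_of_mem (a := f) (Finset.mem_filter.mpr ⟨(hmem f).mpr hcard, ?_⟩)
    have hsupp : ∀ S ∈ (flagExponent r f).support, ∃ s, S = f s := by
      intro S hS
      unfold flagExponent at hS
      obtain ⟨s, -, hs⟩ := Finset.mem_biUnion.mp (Finsupp.support_finsetSum hS)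
      exact ⟨s, Finset.mem_singleton.mp (Finsupp.support_single_subset hs)⟩
    intro S hS T hT
    obtain ⟨s, rfl⟩ := hsupp S hS
    obtain ⟨t, rfl⟩ := hsupp T hT
    rcases le_total (s : ℕ) t with h | h
    · left
      intro i hi
      simp only [f, Finset.mem_filter, Finset.mem_univ, true_and] at hi ⊢
      omega
    · right
      intro i hi
      simp only [f, Finset.mem_filter, Finset.mem_univ, true_and] at hi ⊢
      omega
  · rw [zMonomial_eq_sum, map_sum, Finset.card_filter, Nat.cast_sum, Finset.sum_mul]
    refine Finset.sum_congr rfl fun f hf => ?_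
    rw [degree_mk, polynomialDegree_monomial, monomialDegree,
      sizes_flagExponent ((hmem f).mp hf)]
    split_ifs <;> simp

theorem zMonomial_add (p q : ℕ →₀ ℕ) : zMonomial n (p + q) = zMonomial n p * zMonomial n q :=
  Finsupp.prod_add_index' (h := fun s k => z n s ^ k) (fun _ => pow_zero _)
    (fun _ _ _ => pow_add _ _ _)

theorem prev_succ (p : ℕ →₀ ℕ) (s : ℕ) : prev p (s + 1) = if p s ≠ 0 then s else prev p s := by
  unfold prev
  split_ifs with h
  · refine le_antisymm (Finset.sup_le fun t ht => ?_)
      (Finset.le_sup (f := id) (Finset.mem_filter.mpr ⟨Finsupp.mem_support_iff.mpr h, by omega⟩))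
    exact Nat.lt_succ_iff.mp (Finset.mem_filter.mp ht).2
  · congr 1
    refine Finset.filter_congr fun t ht => ?_
    have : t ≠ s := by
      rintro rfl
      exact h (Finsupp.mem_support_iff.mp ht)
    omega

theorem prev_zero (p : ℕ →₀ ℕ) : prev p 0 = 0 := by simp [prev]

theorem prev_lt (p : ℕ →₀ ℕ) {s : ℕ} (hs : 0 < s) : prev p s < s :=
  (Finset.sup_lt_iff (by simpa using hs)).mpr fun _ ht => (Finset.mem_filter.mp ht).2

theorem BasisIndex.apply_zero (q : BasisIndex n) : q.1 0 = 0 := by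
  by_contra h
  have := Finset.mem_Icc.mp (q.2.1 (Finsupp.mem_support_iff.mpr h))
  omega

theorem BasisIndex.apply_lt (q : BasisIndex n) {s : ℕ} (hs : 0 < s) :
    q.1 s < s - prev q.1 s := by
  by_cases h : q.1 s = 0
  · have := prev_lt q.1 hs
    omega
  · exact q.2.2 s (Finsupp.mem_support_iff.mpr h)

/-- The exponent of the monomial that pairs with `q` to a monomial of nonzero degree. -/
noncomputable def dual (q : BasisIndex n) : ℕ →₀ ℕ :=
  Finsupp.onFinset (Finset.Icc 1 n) (fun s =>
    if s = n then n - prev q.1 n - 1 - q.1 n else if q.1 s ≠ 0 then s - prev q.1 s - q.1 s else 0)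
    (by
      intro s hs
      rw [Finset.mem_Icc]
      split_ifs at hs with h1 h2
      · omega
      · exact Finset.mem_Icc.mp (q.2.1 (Finsupp.mem_support_iff.mpr h2))
      · exact absurd rfl hs)

theorem dual_apply_top (q : BasisIndex n) : dual q n = n - prev q.1 n - 1 - q.1 n := by
  simp [dual]

theorem dual_apply_of_ne (q : BasisIndex n) {s : ℕ} (hs : s ≠ n) :
    dual q s = if q.1 s ≠ 0 then s - prev q.1 s - q.1 s else 0 := by
  simp [dual, hs]

theorem support_dual (q : BasisIndex n) : (dual q).support ⊆ Finset.Icc 1 n :=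
  Finsupp.support_onFinset_subset

theorem add_dual_apply (q : BasisIndex n) {s : ℕ} (hs : s < n) :
    q.1 s + dual q s = if q.1 s ≠ 0 then s - prev q.1 s else 0 := by
  rw [dual_apply_of_ne q hs.ne]
  split_ifs with h
  · have := q.2.2 s (Finsupp.mem_support_iff.mpr h)
    omega
  · omega

theorem sum_add_dual {p : ℕ →₀ ℕ} (q : BasisIndex n) {s : ℕ} (hs : 0 < s) (hsn : s ≤ n)
    (h : ∀ u < s, p u = q.1 u) :
    ∑ u ∈ Finset.range s, (Pi.single 0 1 + ⇑(p + dual q) : ℕ → ℕ) u = 1 + prev q.1 s := by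
  have h1 : ∀ t ≤ s, ∑ u ∈ Finset.range t, (p + dual q) u = prev q.1 t := by
    intro t
    induction t with
    | zero => simp [prev_zero]
    | succ t ih =>
      intro ht
      rw [Finset.sum_range_succ, ih (by omega), prev_succ, Finsupp.add_apply, h t (by omega),
        add_dual_apply q (by omega)]
      split_ifs with h0
      · have : t ≠ 0 := by
          rintro rfl
          exact h0 q.apply_zero
        have := prev_lt q.1 (Nat.pos_of_ne_zero this)
        omega
      · rfl
  simp only [Pi.add_apply, Finset.sum_add_distrib]
  rw [h1 s le_rfl, sum_range_single, if_pos hs]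

theorem chainDegree_add_dual_self (hn : 0 < n) (q : BasisIndex n) :
    chainDegree n (Pi.single 0 1 + ⇑(q.1 + dual q)) ≠ 0 := by
  unfold chainDegree
  rw [Finset.sum_range_succ, sum_add_dual q hn le_rfl fun _ _ => rfl, if_pos]
  · refine Finset.prod_ne_zero_iff.mpr fun s hs => ?_
    obtain ⟨hsn, hs⟩ := mem_levels.mp hs
    have : excess (Pi.single 0 1 + ⇑(q.1 + dual q)) s = 0 := by
      unfold excess
      rcases Nat.eq_zero_or_pos s with rfl | hpos
      · simp [dual_apply_of_ne q hn.ne, q.apply_zero]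
      · rw [Finset.sum_range_succ, sum_add_dual q hpos hsn.le fun _ _ => rfl]
        rw [Pi.add_apply, Pi.single_eq_of_ne hpos.ne', zero_add, Finsupp.add_apply,
          add_dual_apply q hsn] at hs ⊢
        have := prev_lt q.1 hpos
        split_ifs at hs ⊢
        · push_cast
          omega
        · exact absurd rfl hs
    unfold levelWeight
    rw [this, chooseInt_zero_right, chooseInt_zero_right]
    norm_num
  · rw [Pi.add_apply, Pi.single_eq_of_ne hn.ne', zero_add, Finsupp.add_apply, dual_apply_top]
    have := q.apply_lt hn
    omega

theorem chainDegree_add_dual_of_lt {p q : BasisIndex n} (h : toLex p.1 < toLex q.1) :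
    chainDegree n (Pi.single 0 1 + ⇑(p.1 + dual q)) = 0 := by
  obtain ⟨i, hlow, hi⟩ := Finsupp.Lex.lt_iff.mp h
  simp only [ofLex_toLex] at hlow hi
  have hiq : q.1 i ≠ 0 := by omega
  obtain ⟨hi0, hin⟩ := Finset.mem_Icc.mp (q.2.1 (Finsupp.mem_support_iff.mpr hiq))
  have hlt := q.apply_lt hi0
  have hsum := sum_add_dual q hi0 hin hlow
  have hwi : (Pi.single 0 1 + ⇑(p.1 + dual q) : ℕ → ℕ) i = p.1 i + dual q i := by
    rw [Pi.add_apply, Pi.single_eq_of_ne (by omega), zero_add, Finsupp.add_apply]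
  unfold chainDegree
  rcases hin.eq_or_lt with rfl | hin
  · rw [Finset.sum_range_succ, hsum, hwi, dual_apply_top, if_neg (by omega)]
  · rw [dual_apply_of_ne q hin.ne, if_pos hiq] at hwi
    split_ifs with hs
    · refine Finset.prod_eq_zero (mem_levels.mpr ⟨hin, by omega⟩ : i ∈ _) ?_
      unfold levelWeight
      rw [chooseInt_of_neg, zero_mul, neg_zero]
      unfold excess
      rw [Finset.sum_range_succ, hsum, hwi]
      omega
    · rfl

/-- The augmentation of the permutahedral Chow ring. -/
noncomputable def augmentation (n : ℕ) : PermChow n →+* ℤ :=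
  Ideal.Quotient.lift (chowIdeal n) (MvPolynomial.constantCoeff) (by
    intro f hf
    rw [← RingHom.mem_ker]
    refine (sup_le ?_ ?_ : chowIdeal n ≤ _) hf <;> rw [Ideal.span_le]
    · rintro f ⟨S, T, -, -, rfl⟩
      simp [RingHom.mem_ker]
    · rintro f ⟨e, rfl⟩
      simp [RingHom.mem_ker])

theorem linearIndependent_zMonomial (n : ℕ) :
    LinearIndependent ℤ fun p : BasisIndex n => zMonomial n p.1 := by
  rw [linearIndependent_iff']
  intro s g hg
  by_contra! hne
  obtain ⟨q₀, hq₀, hgq₀⟩ := hne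
  obtain ⟨q, hq, hmax⟩ := Finset.exists_max_image (s.filter fun p => g p ≠ 0)
    (fun p => toLex p.1) ⟨q₀, Finset.mem_filter.mpr ⟨hq₀, hgq₀⟩⟩
  obtain ⟨hqs, hgq⟩ := Finset.mem_filter.mp hq
  rcases Nat.eq_zero_or_pos n with rfl | hn
  · have hzero : ∀ p : BasisIndex 0, p.1 = 0 := fun p =>
      Finsupp.support_eq_empty.mp (Finset.subset_empty.mp p.2.1)
    rw [Finset.sum_eq_single q (fun p _ hp => absurd (Subtype.ext ((hzero p).trans
      (hzero q).symm)) hp) (fun h => absurd hqs h)] at hg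
    have := congrArg (augmentation 0) hg
    rw [map_zsmul, hzero q] at this
    simp [zMonomial] at this
    exact hgq this
  · have h := congrArg (fun a => degree n (a * zMonomial n (dual q))) hg
    simp only [zero_mul, map_zero, Finset.sum_mul, map_sum, smul_mul_assoc, map_zsmul,
      ← zMonomial_add] at h
    rw [Finset.sum_eq_single q] at h
    · obtain ⟨N, hN, hdeg⟩ := degree_zMonomial (n := n) (r := q.1 + dual q)
        (Finsupp.support_add.trans (Finset.union_subset q.2.1 (support_dual q)))
      rw [hdeg, smul_eq_mul] at h
      have h1 := chainDegree_add_dual_self hn q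
      exact mul_ne_zero hgq (mul_ne_zero (Nat.cast_ne_zero.mpr hN) h1) h
    · intro p hp hpq
      by_cases hgp : g p = 0
      · rw [hgp, zero_smul]
      · have hle := hmax p (Finset.mem_filter.mpr ⟨hp, hgp⟩)
        have hlt : toLex p.1 < toLex q.1 :=
          lt_of_le_of_ne hle fun h' => hpq (Subtype.ext (toLex.injective h'))
        obtain ⟨N, -, hdeg⟩ := degree_zMonomial (n := n) (r := p.1 + dual q)
          (Finsupp.support_add.trans (Finset.union_subset p.2.1 (support_dual q)))
        rw [hdeg, chainDegree_add_dual_of_lt hlt, mul_zero, smul_zero]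
    · intro h'; exact absurd hqs h'

/-- The element `x_S`, with the convention `x_∅ = 1`. -/
noncomputable def xOrOne (S : Finset (Fin n)) : PermChow n :=
  if h : S.Nonempty then x ⟨S, h⟩ else 1

theorem xOrOne_coe (S : NonemptySubset n) : xOrOne S.1 = x S := dif_pos S.2

theorem xOrOne_empty : xOrOne (∅ : Finset (Fin n)) = 1 := dif_neg (by simp)

theorem xOrOne_mul_eq_zero {S T : Finset (Fin n)} (h1 : ¬ S ⊆ T) (h2 : ¬ T ⊆ S) :
    xOrOne S * xOrOne T = 0 := by
  have hS : S.Nonempty := by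
    rw [Finset.nonempty_iff_ne_empty]
    rintro rfl
    exact h1 (Finset.empty_subset _)
  have hT : T.Nonempty := by
    rw [Finset.nonempty_iff_ne_empty]
    rintro rfl
    exact h2 (Finset.empty_subset _)
  rw [xOrOne, dif_pos hS, xOrOne, dif_pos hT]
  exact x_mul_x_eq_zero h1 h2

theorem sum_xOrOne_filter (P : Finset (Fin n) → Prop) [DecidablePred P] (h : ¬ P ∅) :
    ∑ S : NonemptySubset n with P S.1, x S = ∑ S : Finset (Fin n) with P S, xOrOne S := by
  rw [Finset.sum_filter, Finset.sum_filter, ← sum_nonemptySubset _ (if_neg h)]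
  simp only [xOrOne_coe]

/-- The sum of the `x_U` over all `U` containing `T`. -/
noncomputable def upperSum (T : Finset (Fin n)) : PermChow n :=
  ∑ U : Finset (Fin n) with T ⊆ U, xOrOne U

theorem sum_xOrOne_mem (e : Fin n) : ∑ U : Finset (Fin n) with e ∈ U, xOrOne U = 0 := by
  rw [← sum_xOrOne_filter _ (Finset.notMem_empty e), sum_x_eq_zero]

theorem xOrOne_mul_upperSum_pow (k : ℕ) : ∀ S T : Finset (Fin n), ¬ T ⊆ S → (T \ S).card ≤ k →
    xOrOne S * upperSum T ^ k = 0 := by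
  induction k with
  | zero =>
    intro S T h hk
    exact absurd (Finset.sdiff_eq_empty_iff_subset.mp (Finset.card_eq_zero.mp (by omega))) h
  | succ k ih =>
    intro S T h hk
    obtain ⟨e, heT, heS⟩ := Finset.not_subset.mp h
    have hH : upperSum T + ∑ U : Finset (Fin n) with e ∈ U ∧ ¬ T ⊆ U, xOrOne U = 0 := by
      rw [← sum_xOrOne_mem e, ← Finset.sum_filter_add_sum_filter_not
        (Finset.univ.filter fun U : Finset (Fin n) => e ∈ U) (fun U => T ⊆ U),
        Finset.filter_filter, Finset.filter_filter]
      congr 1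
      refine Finset.sum_congr (Finset.filter_congr fun U _ => ?_) fun _ _ => rfl
      exact ⟨fun h => ⟨h heT, h⟩, fun h => h.2⟩
    suffices xOrOne S * (∑ U : Finset (Fin n) with e ∈ U ∧ ¬ T ⊆ U, xOrOne U) *
        upperSum T ^ k = 0 by
      linear_combination xOrOne S * upperSum T ^ k * hH - this
    rw [Finset.mul_sum, Finset.sum_mul]
    refine Finset.sum_eq_zero fun U hU => ?_
    obtain ⟨-, heU, hTU⟩ := Finset.mem_filter.mp hU
    by_cases hSU : S ⊆ U
    · rw [mul_assoc, ih U T hTU, mul_zero]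
      have : T \ U ⊂ T \ S := by
        refine Finset.ssubset_iff_of_subset (Finset.sdiff_subset_sdiff le_rfl hSU) |>.mpr
          ⟨e, Finset.mem_sdiff.mpr ⟨heT, heS⟩, fun h => (Finset.mem_sdiff.mp h).2 heU⟩
      have := Finset.card_lt_card this
      omega
    · rw [xOrOne_mul_eq_zero hSU fun h => heS (h heU), zero_mul]

theorem add_pow_sub_pow_eq {R : Type*} [CommRing R] {a b c : R} (h : a * b = a * c) (d : ℕ) :
    (a + b) ^ d - b ^ d = (a + c) ^ d - c ^ d := by
  have hpow : ∀ k, a * b ^ k = a * c ^ k := by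
    intro k
    induction k with
    | zero => simp
    | succ k ih =>
      rw [pow_succ, pow_succ]
      linear_combination b * ih + c ^ k * h
  induction d with
  | zero => simp
  | succ d ih =>
    obtain ⟨e, he⟩ : a ∣ (a + b) ^ d - b ^ d := by
      have := sub_dvd_pow_sub_pow (a + b) b d
      rwa [add_sub_cancel_right] at this
    calc (a + b) ^ (d + 1) - b ^ (d + 1)
        = a * ((a + b) ^ d - b ^ d) + b * ((a + b) ^ d - b ^ d) + a * b ^ d := by ring
      _ = a * ((a + b) ^ d - b ^ d) + c * ((a + b) ^ d - b ^ d) + a * c ^ d := by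
        rw [hpow d, he]
        linear_combination e * h
      _ = _ := by rw [ih]; ring

/-- The sum of the `x_S` over all `S` of size at least `u`. -/
noncomputable def tail (n u : ℕ) : PermChow n :=
  ∑ S : Finset (Fin n) with u ≤ S.card, xOrOne S

/-- The part of `tail n _ ^ d` consisting of the chains with smallest member `U`. -/
noncomputable def minPart (d : ℕ) (U : Finset (Fin n)) : PermChow n :=
  (xOrOne U + tail n (U.card + 1)) ^ d - tail n (U.card + 1) ^ d

theorem xOrOne_dvd_minPart (d : ℕ) (U : Finset (Fin n)) : xOrOne U ∣ minPart d U := by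
  have := sub_dvd_pow_sub_pow (xOrOne U + tail n (U.card + 1)) (tail n (U.card + 1)) d
  rwa [add_sub_cancel_right] at this

theorem xOrOne_mul_minPart {S U : Finset (Fin n)} (d : ℕ) (h : ¬ S ⊆ U)
    (hc : S.card ≤ U.card) : xOrOne S * minPart d U = 0 := by
  obtain ⟨e, he⟩ := xOrOne_dvd_minPart d U
  rw [he, ← mul_assoc, xOrOne_mul_eq_zero h, zero_mul]
  exact fun h' => h (Finset.eq_of_subset_of_card_le h' hc).ge

theorem xOrOne_mul_sum {U : Finset (Fin n)} {F : Finset (Finset (Fin n))}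
    (h1 : ∀ V, U ⊂ V → V ∈ F) (h2 : ∀ V ∈ F, U.card ≤ V.card ∧ V ≠ U) :
    xOrOne U * ∑ V ∈ F, xOrOne V = xOrOne U * ∑ V : Finset (Fin n) with U ⊂ V, xOrOne V := by
  rw [Finset.mul_sum, Finset.mul_sum]
  symm
  refine Finset.sum_subset (fun V hV => h1 V (Finset.mem_filter.mp hV).2) fun V hV hV' => ?_
  obtain ⟨hc, hne⟩ := h2 V hV
  refine xOrOne_mul_eq_zero (fun h => hV' ?_) fun h => hne ?_
  · exact Finset.mem_filter.mpr ⟨Finset.mem_univ _, h.ssubset_of_ne hne.symm⟩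
  · exact Finset.eq_of_subset_of_card_le h hc

theorem sum_xOrOne_pow {d : ℕ} (hd : d ≠ 0) (F : Finset (Finset (Fin n)))
    (hF : ∀ U ∈ F, ∀ V, U ⊆ V → V ∈ F) :
    (∑ U ∈ F, xOrOne U) ^ d = ∑ U ∈ F, minPart d U := by
  induction F using Finset.strongInduction with
  | H F ih =>
    rcases F.eq_empty_or_nonempty with rfl | hne
    · simp [hd]
    obtain ⟨U, hU, hmin⟩ := Finset.exists_min_image F Finset.card hne
    have hmin' : ∀ V ∈ F, V ⊆ U → V = U := fun V hV h =>
      Finset.eq_of_subset_of_card_le h (hmin V hV)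
    rw [← Finset.add_sum_erase F _ hU, ← Finset.add_sum_erase F _ hU,
      ← ih (F.erase U) (Finset.erase_ssubset hU), ← sub_eq_iff_eq_add]
    · refine add_pow_sub_pow_eq ?_ d
      refine (xOrOne_mul_sum ?_ ?_).trans (xOrOne_mul_sum ?_ ?_).symm
      · intro V hV
        exact Finset.mem_erase.mpr ⟨hV.ne', hF U hU V hV.subset⟩
      · intro V hV
        exact ⟨hmin V (Finset.mem_of_mem_erase hV), Finset.ne_of_mem_erase hV⟩
      · intro V hV
        exact Finset.mem_filter.mpr ⟨Finset.mem_univ _, Finset.card_lt_card hV⟩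
      · intro V hV
        have := (Finset.mem_filter.mp hV).2
        exact ⟨by omega, by rintro rfl; omega⟩
    · intro V hV W hVW
      refine Finset.mem_erase.mpr ⟨?_, hF V (Finset.mem_of_mem_erase hV) W hVW⟩
      rintro rfl
      exact Finset.ne_of_mem_erase hV (hmin' V (Finset.mem_of_mem_erase hV) hVW)

theorem tail_eq_add (u : ℕ) :
    tail n u = ∑ U : Finset (Fin n) with U.card = u, xOrOne U + tail n (u + 1) := by
  unfold tail
  rw [← Finset.sum_filter_add_sum_filter_not (Finset.univ.filter fun U : Finset (Fin n) =>
    u ≤ U.card) (fun U => U.card = u), Finset.filter_filter, Finset.filter_filter]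
  congr 1 <;> refine Finset.sum_congr (Finset.filter_congr fun U _ => ?_) fun _ _ => rfl <;> omega

theorem tail_pow_sub_tail_pow {d : ℕ} (hd : d ≠ 0) (u : ℕ) :
    tail n u ^ d - tail n (u + 1) ^ d = ∑ U : Finset (Fin n) with U.card = u, minPart d U := by
  have h : ∀ v, tail n v ^ d = ∑ U : Finset (Fin n) with v ≤ U.card, minPart d U := by
    intro v
    refine sum_xOrOne_pow hd _ fun U hU V hUV => ?_
    exact Finset.mem_filter.mpr ⟨Finset.mem_univ _,
      (Finset.mem_filter.mp hU).2.trans (Finset.card_le_card hUV)⟩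
  rw [h, h, sub_eq_iff_eq_add, ← Finset.sum_filter_add_sum_filter_not
    (Finset.univ.filter fun U : Finset (Fin n) => u ≤ U.card) (fun U => U.card = u),
    Finset.filter_filter, Finset.filter_filter]
  congr 1 <;> refine Finset.sum_congr (Finset.filter_congr fun U _ => ?_) fun _ _ => rfl <;> omega

theorem xOrOne_mul_sum_tail {S : Finset (Fin n)} {t : ℕ} (hSt : S.card < t) :
    xOrOne S * ∑ u ∈ Finset.Icc t n, ((u - S.card).choose (t - S.card) : PermChow n) *
      (tail n u ^ (t - S.card) - tail n (u + 1) ^ (t - S.card)) = 0 := by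
  set d := t - S.card with hd
  have hd0 : d ≠ 0 := by omega
  have h1 : ∑ T : Finset (Fin n) with S ⊆ T ∧ T.card = t, xOrOne S * upperSum T ^ d = 0 := by
    refine Finset.sum_eq_zero fun T hT => ?_
    obtain ⟨-, hST, hTt⟩ := Finset.mem_filter.mp hT
    refine xOrOne_mul_upperSum_pow d S T (fun h => ?_) ?_
    · have := Finset.card_le_card h
      omega
    · rw [Finset.card_sdiff_of_subset hST]
      omega
  have h2 : ∀ T : Finset (Fin n), upperSum T ^ d = ∑ U : Finset (Fin n) with T ⊆ U, minPart d U :=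
    fun T => sum_xOrOne_pow hd0 _ fun U hU V hUV => Finset.mem_filter.mpr
      ⟨Finset.mem_univ _, (Finset.mem_filter.mp hU).2.trans hUV⟩
  rw [← h1]
  simp only [h2, tail_pow_sub_tail_pow hd0, Finset.mul_sum, Finset.sum_filter]
  rw [Finset.sum_comm]
  have h3 : ∀ T : Finset (Fin n), (if S ⊆ T ∧ T.card = t then ∑ U : Finset (Fin n),
      xOrOne S * (if T ⊆ U then minPart d U else 0) else 0) = ∑ U : Finset (Fin n),
      if S ⊆ T ∧ T ⊆ U ∧ T.card = t then xOrOne S * minPart d U else 0 := by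
    intro T
    split_ifs with h
    · refine Finset.sum_congr rfl fun U _ => ?_
      simp only [h.1, h.2, true_and, and_true]
      split_ifs <;> simp
    · refine (Finset.sum_eq_zero fun U _ => if_neg fun h' => h ⟨h'.1, h'.2.2⟩).symm
  rw [Finset.sum_congr rfl fun T _ => h3 T, Finset.sum_comm (s := Finset.univ (α := Finset (Fin n)))
    (t := Finset.univ (α := Finset (Fin n)))]
  refine Finset.sum_congr rfl fun U _ => ?_
  rw [← Finset.sum_filter, Finset.sum_const, nsmul_eq_mul]
  have hUn : U.card ≤ n := by simpa using Finset.card_le_univ U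
  by_cases htU : t ≤ U.card
  · rw [Finset.sum_eq_single_of_mem U.card (Finset.mem_Icc.mpr ⟨htU, hUn⟩)
      (fun u _ hu => by rw [if_neg hu.symm, mul_zero, mul_zero]), if_pos rfl]
    by_cases hSU : S ⊆ U
    · rw [card_filter_between hSU hSt.le]
      ring
    · have := xOrOne_mul_minPart d hSU (by omega)
      rw [this, mul_zero, mul_left_comm, this, mul_zero]
  · rw [Finset.sum_eq_zero, Finset.filter_eq_empty_iff.mpr, Finset.card_empty, Nat.cast_zero,
      zero_mul]
    · rintro T - ⟨-, h, h'⟩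
      have := Finset.card_le_card h
      omega
    · intro u hu
      rw [Finset.mem_Icc] at hu
      rw [if_neg (by omega), mul_zero, mul_zero]

/-- The element `z_s`, with the convention `z_0 = 1`. -/
noncomputable def zOrOne (n s : ℕ) : PermChow n :=
  ∑ S : Finset (Fin n) with S.card = s, xOrOne S

theorem zOrOne_zero (n : ℕ) : zOrOne n 0 = 1 := by
  have : (Finset.univ.filter fun S : Finset (Fin n) => S.card = 0) = {∅} := by
    ext S; simp
  rw [zOrOne, this, Finset.sum_singleton, xOrOne_empty]

theorem zOrOne_of_ne_zero {s : ℕ} (hs : s ≠ 0) : zOrOne n s = z n s :=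
  (sum_xOrOne_filter (fun S : Finset (Fin n) => S.card = s) (by simpa using hs.symm)).symm

theorem zOrOne_mul_sum_tail {s t : ℕ} (hst : s < t) :
    zOrOne n s * ∑ u ∈ Finset.Icc t n, ((u - s).choose (t - s) : PermChow n) *
      (tail n u ^ (t - s) - tail n (u + 1) ^ (t - s)) = 0 := by
  rw [zOrOne, Finset.sum_mul]
  refine Finset.sum_eq_zero fun S hS => ?_
  obtain ⟨-, rfl⟩ := Finset.mem_filter.mp hS
  exact xOrOne_mul_sum_tail hst

theorem tail_eq_z_add {u : ℕ} (hu : u ≠ 0) : tail n u = z n u + tail n (u + 1) := by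
  rw [tail_eq_add, ← zOrOne_of_ne_zero hu, zOrOne]

theorem tail_of_lt {u : ℕ} (hu : n < u) : tail n u = 0 := by
  refine Finset.sum_eq_zero fun S hS => ?_
  have h1 := (Finset.mem_filter.mp hS).2
  have h2 : S.card ≤ n := by simpa using Finset.card_le_univ S
  omega

theorem tail_mem_adjoin {t u : ℕ} (htu : t < u) :
    tail n u ∈ Algebra.adjoin ℤ {a | ∃ v, t < v ∧ v ≤ n ∧ a = z n v} := by
  rcases lt_or_ge n u with h | h
  · rw [tail_of_lt h]
    exact zero_mem _
  · induction h using Nat.decreasingInduction with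
    | self =>
      rw [tail_eq_z_add (by omega), tail_of_lt (Nat.lt_succ_self n), add_zero]
      exact Algebra.subset_adjoin ⟨n, htu, le_rfl, rfl⟩
    | of_succ u hu ih =>
      rw [tail_eq_z_add (by omega)]
      exact add_mem (Algebra.subset_adjoin ⟨u, htu, hu.le, rfl⟩) (ih (by omega))

/-- The product `z_s z_t ^ (t - s)` is a combination of terms with a smaller exponent of `z_t`. -/
theorem zOrOne_mul_z_pow {s t : ℕ} (hst : s < t) (htn : t ≤ n) :
    ∃ c : ℕ → PermChow n,
      (∀ a, c a ∈ Algebra.adjoin ℤ {a | ∃ v, t < v ∧ v ≤ n ∧ a = z n v}) ∧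
      zOrOne n s * z n t ^ (t - s) =
        zOrOne n s * ∑ a ∈ Finset.range (t - s), z n t ^ a * c a := by
  set d := t - s with hd
  set W := Algebra.adjoin ℤ {a | ∃ v, t < v ∧ v ≤ n ∧ a = z n v} with hW
  set b := tail n (t + 1) with hb
  have hbW : b ∈ W := tail_mem_adjoin (Nat.lt_succ_self t)
  set E := ∑ u ∈ Finset.Ioc t n, ((u - s).choose (t - s) : PermChow n) *
    (tail n u ^ (t - s) - tail n (u + 1) ^ (t - s)) with hE
  have hEW : E ∈ W := by
    refine sum_mem fun u hu => mul_mem (natCast_mem _ _) (sub_mem (pow_mem ?_ _) (pow_mem ?_ _))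
    · exact tail_mem_adjoin (Finset.mem_Ioc.mp hu).1
    · exact tail_mem_adjoin (by have := (Finset.mem_Ioc.mp hu).1; omega)
  have hrel := zOrOne_mul_sum_tail (n := n) hst
  rw [← Finset.add_sum_Ioc_eq_sum_Icc htn, ← hE, Nat.choose_self, Nat.cast_one, one_mul,
    tail_eq_z_add (by omega), ← hb, ← hd, add_pow, Finset.sum_range_succ, Nat.sub_self, pow_zero,
    Nat.choose_self, Nat.cast_one, mul_one, mul_one] at hrel
  refine ⟨fun a => -(b ^ (d - a) * (d.choose a : PermChow n)) +
    if a = 0 then b ^ d - E else 0, fun a => ?_, ?_⟩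
  · refine add_mem (neg_mem (mul_mem (pow_mem hbW _) (natCast_mem _ _))) ?_
    split_ifs
    · exact sub_mem (pow_mem hbW _) hEW
    · exact zero_mem _
  · have h1 : ∑ a ∈ Finset.range d, z n t ^ a * (-(b ^ (d - a) * (d.choose a : PermChow n)) +
        if a = 0 then b ^ d - E else 0) =
        -(∑ a ∈ Finset.range d, z n t ^ a * b ^ (d - a) * (d.choose a : PermChow n)) +
          (b ^ d - E) := by
      simp only [mul_add, Finset.sum_add_distrib]
      congr 1
      · rw [← Finset.sum_neg_distrib]
        exact Finset.sum_congr rfl fun a _ => by ring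
      · rw [Finset.sum_eq_single_of_mem 0 (Finset.mem_range.mpr (by omega))
          (fun a _ ha => by rw [if_neg ha, mul_zero])]
        simp
    rw [h1]
    linear_combination hrel

/-- The span of the monomials whose exponents agree with `p` below `t` and are smaller at `t`. -/
noncomputable def smallerSpan (n : ℕ) (p : ℕ →₀ ℕ) (t : ℕ) : Submodule ℤ (PermChow n) :=
  Submodule.span ℤ {a | ∃ q : ℕ →₀ ℕ, q.support ⊆ Finset.Icc 1 n ∧ (∀ u < t, q u = p u) ∧
    q t < p t ∧ a = zMonomial n q}

theorem zMonomial_single (s k : ℕ) : zMonomial n (Finsupp.single s k) = z n s ^ k :=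
  Finsupp.prod_single_index (h := fun s k => z n s ^ k) (pow_zero _)

theorem support_add_single_subset {q : ℕ →₀ ℕ} {v k : ℕ} (hq : q.support ⊆ Finset.Icc 1 n)
    (hv : v ∈ Finset.Icc 1 n) : (q + Finsupp.single v k).support ⊆ Finset.Icc 1 n := by
  refine Finsupp.support_add.trans (Finset.union_subset hq ?_)
  exact Finsupp.support_single_subset.trans (Finset.singleton_subset_iff.mpr hv)

theorem mul_mem_smallerSpan {p : ℕ →₀ ℕ} {t : ℕ} {a c : PermChow n}
    (ha : a ∈ smallerSpan n p t)
    (hc : c ∈ Algebra.adjoin ℤ {a | ∃ v, t < v ∧ v ≤ n ∧ a = z n v}) :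
    a * c ∈ smallerSpan n p t := by
  induction hc using Algebra.adjoin_induction generalizing a with
  | mem c hc =>
    obtain ⟨v, htv, hvn, rfl⟩ := hc
    refine Submodule.span_induction ?_ ?_ ?_ ?_ ha
    · rintro _ ⟨q, hq, hqu, hqt, rfl⟩
      refine Submodule.subset_span ⟨q + Finsupp.single v 1,
        support_add_single_subset hq (Finset.mem_Icc.mpr ⟨by omega, hvn⟩), fun u hu => ?_, ?_, ?_⟩
      · rw [Finsupp.add_apply, Finsupp.single_eq_of_ne (by omega), hqu u hu, add_zero]
      · rwa [Finsupp.add_apply, Finsupp.single_eq_of_ne (by omega), add_zero]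
      · rw [zMonomial_add, zMonomial_single, pow_one]
    · rw [zero_mul]; exact zero_mem _
    · intro a b _ _ ha hb
      rw [add_mul]; exact add_mem ha hb
    · intro k a _ ha
      rw [smul_mul_assoc]; exact Submodule.smul_mem _ _ ha
  | algebraMap k =>
    rw [mul_comm, ← Algebra.smul_def]
    exact Submodule.smul_mem _ _ ha
  | add c d _ _ hc hd => rw [mul_add]; exact add_mem (hc ha) (hd ha)
  | mul c d _ _ hc hd => rw [← mul_assoc]; exact hd (hc ha)

theorem apply_prev_ne_zero {p : ℕ →₀ ℕ} {t : ℕ} (h : prev p t ≠ 0) : p (prev p t) ≠ 0 := by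
  have hne : (p.support.filter (· < t)).Nonempty := by
    rw [Finset.nonempty_iff_ne_empty]
    intro h0
    rw [prev, h0, Finset.sup_empty] at h
    exact h rfl
  obtain ⟨u, hu, hus⟩ := Finset.exists_mem_eq_sup _ hne id
  have : prev p t = u := hus
  rw [this]
  exact Finsupp.mem_support_iff.mp (Finset.mem_filter.mp hu).1

theorem zMonomial_mem_smallerSpan {p : ℕ →₀ ℕ} (hp : p.support ⊆ Finset.Icc 1 n) {t : ℕ}
    (ht : t ∈ p.support) (hpt : t - prev p t ≤ p t) : zMonomial n p ∈ smallerSpan n p t := by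
  have htI := hp ht
  obtain ⟨ht1, htn⟩ := Finset.mem_Icc.mp htI
  have hst := prev_lt p ht1
  obtain ⟨c, hc, hrel⟩ := zOrOne_mul_z_pow hst htn
  have hps := apply_prev_ne_zero (p := p) (t := t)
  generalize prev p t = s at hst hps hpt hrel
  generalize hd : t - s = d at hpt hrel
  obtain ⟨p', rfl⟩ : ∃ p', p = p' + Finsupp.single t d :=
    ⟨p - Finsupp.single t d, (tsub_add_cancel_of_le (Finsupp.single_le_iff.mpr hpt)).symm⟩
  have hp' : p'.support ⊆ Finset.Icc 1 n := fun u hu => hp (by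
    rw [Finsupp.mem_support_iff] at hu ⊢
    rw [Finsupp.add_apply]
    omega)
  obtain ⟨w, hw⟩ : zOrOne n s ∣ zMonomial n p' := by
    rcases Nat.eq_zero_or_pos s with h0 | h0
    · rw [h0, zOrOne_zero]; exact one_dvd _
    · have hsmem : p' s ≠ 0 := by
        have := hps h0.ne'
        rwa [Finsupp.add_apply, Finsupp.single_eq_of_ne (by omega), add_zero] at this
      rw [zOrOne_of_ne_zero h0.ne']
      refine (dvd_pow_self _ hsmem).trans ?_
      exact Finset.dvd_prod_of_mem (fun s => z n s ^ p' s) (Finsupp.mem_support_iff.mpr hsmem)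
  have hexp : zMonomial n (p' + Finsupp.single t d) =
      ∑ a ∈ Finset.range d, zMonomial n (p' + Finsupp.single t a) * c a := by
    simp only [zMonomial_add, zMonomial_single]
    calc zMonomial n p' * z n t ^ d = w * (zOrOne n s * z n t ^ d) := by rw [hw]; ring
      _ = zMonomial n p' * ∑ a ∈ Finset.range d, z n t ^ a * c a := by rw [hrel, hw]; ring
      _ = _ := by
        rw [Finset.mul_sum]
        exact Finset.sum_congr rfl fun a _ => by rw [mul_assoc]
  rw [hexp]
  refine sum_mem fun a ha => mul_mem_smallerSpan (Submodule.subset_span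
    ⟨_, support_add_single_subset hp' htI, fun u hu => ?_, ?_, rfl⟩) (hc a)
  · simp only [Finsupp.add_apply, Finsupp.single_eq_of_ne hu.ne]
  · simp only [Finsupp.add_apply, Finsupp.single_eq_same]
    have := Finset.mem_range.mp ha
    omega

theorem zMonomial_mem_span_basis {p : ℕ →₀ ℕ} (hp : p.support ⊆ Finset.Icc 1 n) :
    zMonomial n p ∈ Submodule.span ℤ (Set.range fun q : BasisIndex n => zMonomial n q.1) := by
  have hwf := InvImage.wf (fun p : ℕ →₀ ℕ => (toLex fun i : Fin (n + 1) => p i))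
    (wellFounded_lt (α := Lex (Fin (n + 1) → ℕ)))
  induction p using hwf.induction with
  | _ p ih =>
    by_cases hbasis : ∀ s ∈ p.support, p s < s - prev p s
    · exact Submodule.subset_span ⟨⟨p, hp, hbasis⟩, rfl⟩
    · push Not at hbasis
      obtain ⟨t, ht, hpt⟩ := hbasis
      refine (Submodule.span_le.mpr ?_ : smallerSpan n p t ≤ _) (zMonomial_mem_smallerSpan hp ht hpt)
      rintro _ ⟨q, hq, hqu, hqt, rfl⟩
      refine ih q ?_ hq
      have htn := (Finset.mem_Icc.mp (hp ht)).2
      exact ⟨⟨t, by omega⟩, fun j hj => hqu j hj, hqt⟩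

theorem adjoin_z_le_span_basis :
    Subalgebra.toSubmodule (Algebra.adjoin ℤ {a | ∃ s ∈ Finset.Icc 1 n, a = z n s}) ≤
      Submodule.span ℤ (Set.range fun q : BasisIndex n => zMonomial n q.1) := by
  rw [Algebra.adjoin_eq_span, Submodule.span_le]
  intro a ha
  suffices ∃ p : ℕ →₀ ℕ, p.support ⊆ Finset.Icc 1 n ∧ a = zMonomial n p by
    obtain ⟨p, hp, rfl⟩ := this
    exact zMonomial_mem_span_basis hp
  induction ha using Submonoid.closure_induction with
  | mem a ha =>
    obtain ⟨s, hs, rfl⟩ := ha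
    refine ⟨Finsupp.single s 1, ?_, by rw [zMonomial_single, pow_one]⟩
    exact Finsupp.support_single_subset.trans (Finset.singleton_subset_iff.mpr hs)
  | one => exact ⟨0, by simp, by simp [zMonomial]⟩
  | mul a b _ _ ha hb =>
    obtain ⟨p, hp, rfl⟩ := ha
    obtain ⟨q, hq, rfl⟩ := hb
    exact ⟨p + q, Finsupp.support_add.trans (Finset.union_subset hp hq), (zMonomial_add p q).symm⟩

theorem uniformMatroid_indep_iff {r : ℕ} (I : Finset (Fin n)) :
    (uniformMatroid r n).Indep (I : Set (Fin n)) ↔ I.card ≤ r := by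
  unfold uniformMatroid
  rw [IndepMatroid.matroid_Indep]
  exact @IndepMatroid.ofFinset_indep _ _ _ _ _ _ _ _ _

theorem rank_uniformMatroid (r : ℕ) (S : Finset (Fin n)) :
    rank (uniformMatroid r n) S = min S.card r := by
  have hcard : ∀ T : Finset (Fin n), (uniformMatroid r n).Indep (T : Set (Fin n)) →
      rank (uniformMatroid r n) T = T.card := fun T hT => by
    rw [rank, hT.eRk_eq_encard, Set.encard_coe_eq_coe_finsetCard, ENat.toNat_natCast]
  have hfin : (uniformMatroid r n).eRk (S : Set (Fin n)) ≠ ⊤ := by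
    refine ne_top_of_le_ne_top ?_ ((uniformMatroid r n).eRk_le_encard _)
    rw [Set.encard_coe_eq_coe_finsetCard]
    exact ENat.natCast_ne_top _
  refine le_antisymm (le_min (rank_le_card _ S) ?_) ?_
  · refine ENat.toNat_le_of_le_natCast ((Matroid.eRk_le_iff).mpr fun I _ hI => ?_)
    lift I to Finset (Fin n) using I.toFinite
    rw [Set.encard_coe_eq_coe_finsetCard]
    exact_mod_cast (uniformMatroid_indep_iff I).mp hI
  · obtain ⟨T, hTS, hT⟩ := Finset.exists_subset_card_eq (min_le_left S.card r)
    rw [← hT, ← hcard T ((uniformMatroid_indep_iff T).mpr (hT ▸ min_le_right _ _))]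
    exact ENat.toNat_le_toNat (Matroid.eRk_mono _ (by exact_mod_cast hTS)) hfin

theorem z_eq_y {r s : ℕ} : z n s = y (uniformMatroid r n) (min s r) (s - min s r) := by
  unfold z y nullity
  refine Finset.sum_congr (Finset.filter_congr fun S _ => ?_) fun _ _ => rfl
  rw [rank_uniformMatroid]
  omega

theorem z_of_notMem_Icc {s : ℕ} (hs : s ∉ Finset.Icc 1 n) : z n s = 0 := by
  refine Finset.sum_eq_zero fun S hS => ?_
  refine absurd (Finset.mem_Icc.mpr ?_) hs
  rw [← (Finset.mem_filter.mp hS).2]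
  exact ⟨Finset.card_pos.mpr S.2, by simpa using Finset.card_le_univ S.1⟩

theorem rankNullityRing_uniformMatroid (r n : ℕ) :
    rankNullityRing (uniformMatroid r n) =
      Algebra.adjoin ℤ {a | ∃ s ∈ Finset.Icc 1 n, a = z n s} := by
  refine le_antisymm (Algebra.adjoin_le ?_) (Algebra.adjoin_le ?_)
  · rintro _ ⟨i, j, -, -, rfl⟩
    by_cases hi : i = min (i + j) r
    · have : y (uniformMatroid r n) i j = z n (i + j) := by
        rw [z_eq_y (r := r), ← hi, Nat.add_sub_cancel_left]
      rw [this]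
      by_cases hmem : i + j ∈ Finset.Icc 1 n
      · exact Algebra.subset_adjoin ⟨_, hmem, rfl⟩
      · rw [z_of_notMem_Icc hmem]; exact zero_mem _
    · have : y (uniformMatroid r n) i j = 0 := by
        refine Finset.sum_eq_zero fun S hS => absurd ?_ hi
        obtain ⟨-, h1, h2⟩ := Finset.mem_filter.mp hS
        rw [nullity, rank_uniformMatroid] at h2
        rw [rank_uniformMatroid] at h1
        omega
      rw [this]; exact zero_mem _
  · rintro _ ⟨s, hs, rfl⟩
    have := Finset.mem_Icc.mp hs
    exact Algebra.subset_adjoin ⟨min s r, s - min s r, by omega, by omega, z_eq_y⟩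

theorem zMonomial_mem_rankNullityRing (r : ℕ) (p : BasisIndex n) :
    zMonomial n p.1 ∈ rankNullityRing (uniformMatroid r n) := by
  rw [rankNullityRing_uniformMatroid]
  refine prod_mem fun s hs => pow_mem ?_ _
  exact Algebra.subset_adjoin ⟨s, p.2.1 hs, rfl⟩

end RankNullity

theorem mainTheorem4 (r n : ℕ) (hrn : r ≤ n) :
    ∃ b : Module.Basis (RankNullity.BasisIndex n) ℤ
        (RankNullity.rankNullityRing (RankNullity.uniformMatroid r n)),
      ∀ p : RankNullity.BasisIndex n,
        (b p : RankNullity.PermChow n) = RankNullity.zMonomial n p.1 := by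
  let v : RankNullity.BasisIndex n →
      RankNullity.rankNullityRing (RankNullity.uniformMatroid r n) := fun p =>
    ⟨RankNullity.zMonomial n p.1, RankNullity.zMonomial_mem_rankNullityRing r p⟩
  let ι := (Subalgebra.toSubmodule
    (RankNullity.rankNullityRing (RankNullity.uniformMatroid r n))).subtype
  have hli : LinearIndependent ℤ v :=
    LinearIndependent.of_comp ι (RankNullity.linearIndependent_zMonomial n)
  have hspan : ⊤ ≤ Submodule.span ℤ (Set.range v) := by
    rintro ⟨a, ha⟩ -
    have h1 := ha
    rw [RankNullity.rankNullityRing_uniformMatroid] at h1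
    have h2 := RankNullity.adjoin_z_le_span_basis h1
    have h3 : (Set.range fun q : RankNullity.BasisIndex n => RankNullity.zMonomial n q.1) =
        ι '' Set.range v := by
      rw [← Set.range_comp]
      rfl
    rw [h3, ← Submodule.map_span] at h2
    obtain ⟨b, hb, hba⟩ := h2
    have : b = ⟨a, ha⟩ := Subtype.ext hba
    rwa [← this]
  exact ⟨Module.Basis.mk hli hspan, fun p => by rw [Module.Basis.mk_apply]⟩
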